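/- **Proposition 3.7 (label canonicalness).** Let $F$ be a non-archimedean local field of odd residue characteristic $p$, let $E/F$ be the unramified quadratic extension with non-trivial automorphism $x\mapsto\bar x$, and let $\varpi\in F$ be a uniformizer of $E$. Let $\mathfrak o_E$ and $\mathfrak p_E$ be the ring of integers of $E$ and its maximal ideal. Let $G=U(2,1)(E/F)$ be the group of all $g\in GL_3(E)$ preserving the Hermitian form $(v,w)\mapsto v^{T}\beta\bar w$, where $\beta$ is the antidiagonal matrix with entries $1$, and put $\alpha=\mathrm{diag}(\varpi^{-1},1,\varpi)\in G$. Let $K$ be one of the two maximal compact subgroups $$K_0=GL_3(\mathfrak o_E)\cap G,\qquad K_1=\begin{pmatrix}\mathfrak o_E&\mathfrak o_E&\mathfrak p_E^{-1}\\ \mathfrak p_E&\mathfrak o_E&\mathfrak o_E\\ \mathfrak p_E&\mathfrak p_E&\mathfrak o_E\end{pmatrix}\cap G .$$ Let $K^1$ be the maximal normal pro-$p$ subgroup of $K$, and let $I_K$ (resp. $I_{1,K}$) be the preimage in $K$ of the upper triangular (resp. unipotent upper triangular) subgroup of the finite group $K/K^1$. Explicitly, $I_K$ consists of the $g\in K$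 with $g_{21},g_{31},g_{32}\in\mathfrak p_E$ if $K=K_0$, and of the $g\in K$ with $g_{31}\in\mathfrak p_E^2$ if $K=K_1$; and $I_{1,K}$ consists of the $g\in I_K$ whose diagonal entries lie in $1+\mathfrak p_E$. All representations are over $\overline{\mathbf F}_p$. A weight of $K$ is an irreducible smooth representation of $K$. For a weight $\sigma$, let $\mathrm{ind}_K^G\sigma$ be the space of locally constant, compactly supported functions $f:G\to\sigma$ with $f(kg)=\sigma(k)f(g)$ for all $k\in K$ and $g\in G$, on which $G$ acts by right translation. For $n\in\mathbf Z$ let $S_n(\sigma)$ be the subspace of the functions supported in $K\alpha^nI_K$, and put $I^+(\sigma)=\bigoplus_{n\ge 0}S_n(\sigma)$ and $I^-(\sigma)=\bigoplus_{n\ge 1}S_{-n}(\sigma)$. If $\pi$ is a smooth representation of $G$ and $\sigma$ is contained in $\pi$ through an injective $K$-map $j:\sigma\to\pi$, let $I^{\pm}(\sigma,\pi)$ be the image of $I^{\pm}(\sigma)$ under the $G$-map $\mathrm{ind}_K^G\sigma\to\pi$ that corresponds to $j$ by Frobenius reciprocity, $f\mapsto\sum_{g\in K\backslash G}\pi(g^{-1})\,j(f(g))$.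 The intersection $I^+(\sigma,\pi)\cap I^-(\sigma,\pi)$ is an $I_K$-subrepresentation of $\pi$. Let $\pi$ be an irreducible smooth representation of $G$ and let $\sigma$ be a weight of $K$ contained in $\pi$ such that $$\pi^{I_{1,K}}\subseteq I^+(\sigma,\pi)\cap I^-(\sigma,\pi).$$ Then the $I_K$-subrepresentation $I^+(\sigma,\pi)\cap I^-(\sigma,\pi)$ of $\pi$ does not depend on the choice of $\sigma$: for every weight $\sigma'$ of $K$ contained in $\pi$ (and every embedding of it into $\pi$), $$I^+(\sigma',\pi)\cap I^-(\sigma',\pi)=I^+(\sigma,\pi)\cap I^-(\sigma,\pi).$$ -/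

import Mathlib

open ValuativeRel Pointwise

noncomputable section

namespace UnramifiedU3

/-! ### Invariance of the valuation of a quadratic extension of local fields -/

section Quadratic

variable {F E : Type*} [Field F] [Field E] [Algebra F E]

theorem exists_quadratic_relation [Algebra.IsQuadraticExtension F E] (x : E) :
    ∃ t n : F, x ^ 2 = algebraMap F E t * x - algebraMap F E n := by
  have h2 : Module.finrank F E = 2 := Algebra.IsQuadraticExtension.finrank_eq_two F E
  have hd := LinearMap.charpoly_natDegree (Algebra.lmul F E x)
  have hm := LinearMap.charpoly_monic (Algebra.lmul F E x)
  have h0 := LinearMap.aeval_self_charpoly (Algebra.lmul F E x)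
  rw [h2] at hd
  have h1 : Polynomial.aeval x (Algebra.lmul F E x).charpoly = 0 := by
    have := congrArg (fun f => f 1) h0
    rw [Polynomial.aeval_algHom_apply] at this
    simpa using this
  have hc : (Algebra.lmul F E x).charpoly.coeff 2 = 1 := by
    rw [← hd]; exact hm
  rw [Polynomial.aeval_eq_sum_range, hd] at h1
  generalize (Algebra.lmul F E x).charpoly = P at h1 hc
  simp only [Finset.sum_range_succ, Finset.range_zero, Finset.sum_empty, hc,
    Algebra.smul_def, map_one] at h1
  refine ⟨-P.coeff 1, P.coeff 0, ?_⟩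
  rw [map_neg]
  linear_combination h1

theorem conj_eq_or (c : E ≃ₐ[F] E) {x : E} {t n : F}
    (h : x ^ 2 = algebraMap F E t * x - algebraMap F E n) :
    c x = x ∨ algebraMap F E t = x + c x := by
  have h' := congrArg c h
  simp only [map_pow, map_sub, map_mul, AlgEquiv.commutes] at h'
  have : (c x - x) * (x + c x - algebraMap F E t) = 0 := by linear_combination h' - h
  rcases mul_eq_zero.1 this with h | h
  · exact Or.inl (sub_eq_zero.1 h)
  · exact Or.inr (sub_eq_zero.1 h).symm

end Quadratic

section Valuation

variable {F E : Type*} [Field F] [ValuativeRel F] [TopologicalSpace F]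
  [IsNonarchimedeanLocalField F] [Field E] [ValuativeRel E] [Algebra F E]
  [ValuativeExtension F E] [Algebra.IsQuadraticExtension F E]

theorem exists_root_of_valuation_lt_one (a : F) (ha : valuation F a < 1) :
    ∃ r : F, r ^ 2 - r + a = 0 := by
  let := IsTopologicalAddGroup.rightUniformSpace F
  have := isUniformAddGroup_of_addCommGroup (G := F)
  let a' : 𝒪[F] := ⟨a, ha.le⟩
  have ham : a' ∈ 𝓂[F] := by
    rw [IsLocalRing.mem_maximalIdeal, mem_nonunits_iff]
    intro hu
    have := (Valuation.integer.integers (valuation F)).isUnit_iff_valuation_eq_one.1 hu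
    exact ha.ne this
  obtain ⟨r, hr, -⟩ := HenselianRing.is_henselian (I := 𝓂[F])
    (Polynomial.X ^ 2 - Polynomial.X + Polynomial.C a' : Polynomial 𝒪[F])
    (by monicity!) 0 (by simpa using ham) (by simp)
  refine ⟨r, ?_⟩
  simpa [Polynomial.IsRoot, a'] using congrArg (Subtype.val) hr

theorem valuation_conj_le (c : E ≃ₐ[F] E) (x : E) : valuation E (c x) ≤ valuation E x := by
  by_contra! hlt
  have hne : c x ≠ x := fun h => by simp [h] at hlt
  obtain ⟨t, n, h⟩ := exists_quadratic_relation (F := F) x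
  have ht : algebraMap F E t = x + c x := (conj_eq_or c h).resolve_left hne
  have hn : algebraMap F E n = x * c x := by rw [ht] at h; linear_combination h
  have hvt : valuation E (algebraMap F E t) = valuation E (c x) := by
    rw [ht, add_comm, Valuation.map_add_eq_of_lt_left _ hlt]
  have hcx : valuation E (c x) ≠ 0 := (lt_of_le_of_lt zero_le hlt).ne'
  have ht0 : t ≠ 0 := by
    rintro rfl
    rw [map_zero, map_zero] at hvt
    exact hcx hvt.symm
  have hE : valuation E (algebraMap F E (n / t ^ 2)) < valuation E (algebraMap F E 1) := by
    rw [map_div₀, map_pow, map_div₀, map_pow, hvt, hn, map_mul, map_one, map_one, pow_two,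
      mul_div_mul_right _ _ hcx, div_lt_one₀ (zero_lt_iff.2 hcx)]
    exact hlt
  have hF : valuation F (n / t ^ 2) < 1 := by
    rw [← map_one (valuation F)]
    rw [← not_le] at hE ⊢
    rw [← Valuation.Compatible.vle_iff_le (v := valuation F)]
    rw [← Valuation.Compatible.vle_iff_le (v := valuation E),
      ValuativeExtension.vle_iff_vle] at hE
    exact hE
  obtain ⟨r, hr⟩ := exists_root_of_valuation_lt_one _ hF
  have hs : (t * r) ^ 2 - t * (t * r) + n = 0 := by
    have : n = n / t ^ 2 * t ^ 2 := by field_simp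
    rw [this]; linear_combination t ^ 2 * hr
  have hs' := congrArg (algebraMap F E) hs
  simp only [map_add, map_sub, map_pow, map_zero, map_mul] at hs'
  rw [← map_mul, hn, ht] at hs'
  have : (algebraMap F E (t * r) - x) * (algebraMap F E (t * r) - c x) = 0 := by
    linear_combination hs'
  rcases mul_eq_zero.1 this with h | h
  · exact hne (by rw [← sub_eq_zero.1 h, AlgEquiv.commutes])
  · have h2 := sub_eq_zero.1 h
    rw [← c.commutes] at h2
    have h3 := c.injective h2
    exact hne (by rw [← h3, AlgEquiv.commutes])

theorem valuation_conj (c : E ≃ₐ[F] E) (x : E) : valuation E (c x) = valuation E x :=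
  le_antisymm (valuation_conj_le c x) (by simpa using valuation_conj_le c.symm (c x))

end Valuation

theorem isOpen_valuation_sub_le {E : Type*} [Field E] [ValuativeRel E] [TopologicalSpace E]
    [IsValuativeTopology E] (z : E) (γ : ValueGroupWithZero E) (h : γ ≠ 0) :
    IsOpen {x : E | valuation E (x - z) ≤ γ} := by
  rw [isOpen_iff_mem_nhds]
  intro x hx
  rw [IsValuativeTopology.mem_nhds_iff']
  refine ⟨Units.mk0 γ h, fun y hy => ?_⟩
  have hy' : valuation E (y - x) < γ := hy
  have : y - z = (y - x) + (x - z) := by ring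
  rw [Set.mem_ofPred_eq, this]
  exact (Valuation.map_add _ _ _).trans (max_le hy'.le hx)

/-! ### The unitary group -/

section Unitary

variable {F E : Type*} [Field F] [Field E] [Algebra F E]

/-- The antidiagonal matrix `β`, the Gram matrix of the Hermitian form. -/
def antidiag (E : Type*) [Field E] : Matrix (Fin 3) (Fin 3) E := !![0, 0, 1; 0, 1, 0; 1, 0, 0]

/-- The Hermitian form `h(v, w) = vᵀ β c(w)` on `E³`, where `c` is the conjugation of `E / F`. -/
def herm (c : E ≃ₐ[F] E) (v w : Fin 3 → E) : E :=
  dotProduct v ((antidiag E).mulVec fun i => c (w i))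

/-- The group `G = U(2,1)(E / F)`: the elements of `GL₃(E)` that preserve the form `herm c`. It
carries the topology induced from `GL₃(E)`. -/
def U3 (c : E ≃ₐ[F] E) : Subgroup (GL (Fin 3) E) where
  carrier := {g | ∀ v w : Fin 3 → E,
    herm c (g.1.mulVec v) (g.1.mulVec w) = herm c v w}
  one_mem' v w := by simp
  mul_mem' {g h} hg hh v w := by
    rw [Units.val_mul, ← Matrix.mulVec_mulVec, ← Matrix.mulVec_mulVec]
    exact (hg _ _).trans (hh v w)
  inv_mem' {g} hg v w := by
    have := hg ((g⁻¹).1.mulVec v) ((g⁻¹).1.mulVec w)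
    simpa [Matrix.mulVec_mulVec] using this.symm

theorem herm_eq (c : E ≃ₐ[F] E) (v w : Fin 3 → E) :
    herm c v w = v 0 * c (w 2) + v 1 * c (w 1) + v 2 * c (w 0) := by
  simp [herm, antidiag, dotProduct, Matrix.mulVec, Fin.sum_univ_three]

theorem herm_single_right (c : E ≃ₐ[F] E) (v : Fin 3 → E) (a : Fin 3) :
    herm c v (Pi.single a.rev 1) = v a := by
  fin_cases a <;> simp [herm_eq, Fin.rev, Fin.ext_iff]

theorem herm_single_left (c : E ≃ₐ[F] E) (w : Fin 3 → E) (b : Fin 3) :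
    herm c (Pi.single b 1) w = c (w b.rev) := by
  fin_cases b <;> simp [herm_eq, Fin.rev, Fin.ext_iff]

/-- The entries of the inverse of a unitary matrix. -/
theorem U3.inv_apply {c : E ≃ₐ[F] E} (g : U3 c) (a b : Fin 3) :
    (g⁻¹ : U3 c).1.1 a b = c (g.1.1 b.rev a.rev) := by
  have h := g.2 ((g⁻¹ : U3 c).1.1.mulVec (Pi.single b 1)) (Pi.single a.rev 1)
  rw [Matrix.mulVec_mulVec] at h
  have h1 : g.1.1 * (g⁻¹ : U3 c).1.1 = 1 := by
    rw [← Units.val_mul, ← Subgroup.coe_mul, mul_inv_cancel]; rfl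
  rw [h1, Matrix.one_mulVec, herm_single_left, herm_single_right] at h
  simpa using h.symm

/-- The diagonal element `α = diag(ϖ⁻¹, 1, ϖ)` of `G`, for `ϖ` in `Fˣ`. -/
def alpha (c : E ≃ₐ[F] E) (ϖ : Fˣ) : U3 c :=
  ⟨⟨Matrix.diagonal ![(algebraMap F E ϖ)⁻¹, 1, algebraMap F E ϖ],
    Matrix.diagonal ![algebraMap F E ϖ, 1, (algebraMap F E ϖ)⁻¹],
    by
      rw [Matrix.diagonal_mul_diagonal, ← Matrix.diagonal_one]
      congr 1; funext i; fin_cases i <;> simp,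
    by
      rw [Matrix.diagonal_mul_diagonal, ← Matrix.diagonal_one]
      congr 1; funext i; fin_cases i <;> simp⟩,
    fun v w => by
      have h : algebraMap F E ϖ ≠ 0 := by simp
      simp only [herm_eq, Matrix.mulVec_diagonal, Matrix.cons_val, map_mul, map_inv₀,
        AlgEquiv.commutes, map_one]
      field_simp⟩

end Unitary

/-! ### Maximal compact and Iwahori subgroups -/

/-- Exponents `e a b` such that the matrices in `GL₃(E)` with `(a, b)` entry in `𝔭 ^ (e a b)` for
all `a` and `b` cut out a subgroup of the unitary group. -/
structure IsGroupExponent (e : Matrix (Fin 3) (Fin 3) ℤ) : Prop where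
  diag : ∀ a, e a a = 0
  triangle : ∀ a b d, e a b ≤ e a d + e d b
  rev : ∀ a b, e b.rev a.rev = e a b

/-- The exponents of the maximal compact subgroups `K₀` and `K₁`. -/
def compactExponent : Fin 2 → Matrix (Fin 3) (Fin 3) ℤ :=
  ![!![0, 0, 0; 0, 0, 0; 0, 0, 0], !![0, 0, -1; 1, 0, 0; 1, 1, 0]]

/-- The exponents of the upper Iwahori subgroups of `K₀` and `K₁`. -/
def iwahoriExponent : Fin 2 → Matrix (Fin 3) (Fin 3) ℤ :=
  ![!![0, 0, 0; 1, 0, 0; 1, 1, 0], !![0, 0, -1; 1, 0, 0; 2, 1, 0]]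

theorem compactExponent_isGroupExponent (i : Fin 2) : IsGroupExponent (compactExponent i) where
  diag := by revert i; decide
  triangle := by revert i; decide
  rev := by
    intro a b
    fin_cases i <;> fin_cases a <;> fin_cases b <;> rfl

theorem iwahoriExponent_isGroupExponent (i : Fin 2) : IsGroupExponent (iwahoriExponent i) where
  diag := by revert i; decide
  triangle := by revert i; decide
  rev := by
    intro a b
    fin_cases i <;> fin_cases a <;> fin_cases b <;> rfl

theorem iwahoriExponent_offDiag (i : Fin 2) :
    ∀ a d, d ≠ a → 1 ≤ iwahoriExponent i a d + iwahoriExponent i d a := by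
  revert i; decide

section Subgroups

variable {F E : Type*} [Field F] [ValuativeRel F] [TopologicalSpace F]
  [IsNonarchimedeanLocalField F] [Field E] [ValuativeRel E] [TopologicalSpace E]
  [IsNonarchimedeanLocalField E] [Algebra F E] [ValuativeExtension F E]
  [Algebra.IsQuadraticExtension F E]

theorem uniformizer_zpow_anti {m n : ℤ} (h : m ≤ n) : uniformizer E ^ n ≤ uniformizer E ^ m :=
  zpow_le_zpow_right_of_le_one₀ uniformizer_pos uniformizer_lt_one.le h

/-- The subgroup of those `g` in the unitary group whose `(a, b)` entry lies in `𝔭_E ^ (e a b)`. -/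
def exponentSubgroup (c : E ≃ₐ[F] E) (e : Matrix (Fin 3) (Fin 3) ℤ) (he : IsGroupExponent e) :
    Subgroup (U3 c) where
  carrier := {g | ∀ a b, valuation E (g.1.1 a b) ≤ uniformizer E ^ e a b}
  one_mem' a b := by
    by_cases h : a = b
    · subst h; simp [he.diag]
    · simp [h]
  mul_mem' {g h} hg hh a b := by
    rw [Subgroup.coe_mul, Units.val_mul, Matrix.mul_apply]
    refine Valuation.map_sum_le _ fun d _ => ?_
    rw [map_mul]
    refine (mul_le_mul' (hg a d) (hh d b)).trans ?_
    rw [← zpow_add₀ uniformizer_ne_zero]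
    exact uniformizer_zpow_anti (he.triangle a b d)
  inv_mem' {g} hg a b := by
    rw [U3.inv_apply, valuation_conj, ← he.rev]
    exact hg _ _

/-- The maximal compact subgroups `K₀` (for `i = 0`) and `K₁` (for `i = 1`) of `G`. -/
def maxCompact (c : E ≃ₐ[F] E) (i : Fin 2) : Subgroup (U3 c) :=
  exponentSubgroup c (compactExponent i) (compactExponent_isGroupExponent i)

/-- The Iwahori subgroup `I_K` of `K = K_i`: the preimage in `K` of the upper triangular
matrices of `Γ_K = K / K¹`. -/
def iwahori (c : E ≃ₐ[F] E) (i : Fin 2) : Subgroup (U3 c) :=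
  exponentSubgroup c (iwahoriExponent i) (iwahoriExponent_isGroupExponent i)

/-- The pro-`p` Iwahori subgroup `I_{1,K}` of `K = K_i`: the preimage in `K` of the unipotent
upper triangular matrices of `Γ_K = K / K¹`. -/
def proIwahori (c : E ≃ₐ[F] E) (i : Fin 2) : Subgroup (U3 c) where
  carrier := {g | g ∈ iwahori c i ∧ ∀ a, valuation E (g.1.1 a a - 1) ≤ uniformizer E}
  one_mem' := ⟨one_mem _, fun a => by simp⟩
  mul_mem' {g h} hg hh := by
    refine ⟨mul_mem hg.1 hh.1, fun a => ?_⟩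
    rw [Subgroup.coe_mul, Units.val_mul, Matrix.mul_apply,
      ← Finset.add_sum_erase _ _ (Finset.mem_univ a), add_sub_right_comm]
    refine (Valuation.map_add _ _ _).trans (max_le ?_ (Valuation.map_sum_le _ fun d hd => ?_))
    · have : g.1.1 a a * h.1.1 a a - 1 =
          (g.1.1 a a - 1) * h.1.1 a a + (h.1.1 a a - 1) := by ring
      rw [this]
      refine (Valuation.map_add _ _ _).trans (max_le ?_ (hh.2 a))
      rw [map_mul]
      refine (mul_le_mul' (hg.2 a) (hh.1 a a)).trans ?_
      rw [(iwahoriExponent_isGroupExponent i).diag, zpow_zero, mul_one]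
    · rw [map_mul]
      refine (mul_le_mul' (hg.1 a d) (hh.1 d a)).trans ?_
      rw [← zpow_add₀ uniformizer_ne_zero]
      refine (uniformizer_zpow_anti
        (iwahoriExponent_offDiag i a d (Finset.ne_of_mem_erase hd))).trans ?_
      rw [zpow_one]
  inv_mem' {g} hg := by
    refine ⟨inv_mem hg.1, fun a => ?_⟩
    rw [U3.inv_apply, ← map_one c, ← map_sub, valuation_conj]
    exact hg.2 _

theorem isOpen_maxCompact (c : E ≃ₐ[F] E) (i : Fin 2) :
    IsOpen (maxCompact c i : Set (U3 c)) := by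
  have : (maxCompact c i : Set (U3 c)) = ⋂ a : Fin 3, ⋂ b : Fin 3,
      (fun g : U3 c => g.1.1 a b) ⁻¹'
        {x | valuation E (x - 0) ≤ uniformizer E ^ compactExponent i a b} := by
    ext g
    simp only [Set.mem_iInter, Set.mem_preimage, Set.mem_ofPred_eq, sub_zero]
    rfl
  rw [this]
  refine isOpen_iInter_of_finite fun a => isOpen_iInter_of_finite fun b => ?_
  refine (isOpen_valuation_sub_le 0 _ (zpow_ne_zero _ uniformizer_ne_zero)).preimage ?_
  exact (Units.continuous_val.comp continuous_subtype_val).matrix_elem a b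

/-- For `E / F` quadratic: `E / F` is unramified, that is, its ramification index is `1` (the
residue fields are finite, so the residue extension is separable). -/
def IsUnramified (F E : Type*) [Field F] [Field E] [ValuativeRel E] [Algebra F E] : Prop :=
  ∀ x : E, ∃ y : F, valuation E x = valuation E (algebraMap F E y)

end Subgroups

/-! ### Smooth representations and compact induction -/

section CompactInduction

/-- A representation of a topological group is smooth if all stabilizers of vectors are open. -/
def IsSmooth {k G V : Type*} [Field k] [Group G] [TopologicalSpace G] [AddCommGroup V]
    [Module k V] (π : Representation k G V) : Prop :=
  ∀ v : V, IsOpen {g : G | π g v = v}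

variable {k G V W : Type*} [Field k] [Group G] [TopologicalSpace G] [IsTopologicalGroup G]
  [AddCommGroup V] [Module k V] [AddCommGroup W] [Module k W]

/-- The restriction of a representation to a subgroup. -/
abbrev res (π : Representation k G V) (H : Subgroup G) : Representation k H V :=
  π.comp H.subtype

/-- The space `S(G, σ)` of the compact induction: locally constant compactly supported functions
`f : G → W` with `f (x g) = σ x (f g)` for `x ∈ K`. -/
def compactInd (K : Subgroup G) (σ : Representation k K W) : Submodule k (G → W) where
  carrier := {f | (∀ (x : K) (g : G), f (x * g) = σ x (f g)) ∧ IsLocallyConstant f ∧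
    HasCompactSupport f}
  zero_mem' := ⟨fun x g => by simp, IsLocallyConstant.const 0, HasCompactSupport.zero⟩
  add_mem' {f f'} hf hf' := ⟨fun x g => by simp [hf.1, hf'.1], hf.2.1.add hf'.2.1,
    hf.2.2.add hf'.2.2⟩
  smul_mem' r f hf := ⟨fun x g => by simp [hf.1], hf.2.1.comp (r • ·),
    hf.2.2.comp_left (g := (r • ·)) (smul_zero r)⟩

/-- The action of `G` on the compact induction by right translation. -/
def compactIndRep (K : Subgroup G) (σ : Representation k K W) :
    Representation k G (compactInd K σ) where
  toFun g :=
    { toFun f := ⟨fun x => f.1 (x * g), fun x y => by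
          show f.1 (x * y * g) = _
          rw [mul_assoc, f.2.1],
        f.2.2.1.comp_continuous (continuous_mul_const g),
        f.2.2.2.comp_homeomorph (Homeomorph.mulRight g)⟩
      map_add' _ _ := rfl
      map_smul' _ _ := rfl }
  map_one' := by ext f x; simp
  map_mul' g h := by ext f x; simp [mul_assoc]

theorem compactIndRep_apply (K : Subgroup G) (σ : Representation k K W) (g : G)
    (f : compactInd K σ) (x : G) : (compactIndRep K σ g f).1 x = f.1 (x * g) := rfl

/-- The function on `K \ G` that is summed in Frobenius reciprocity, `g ↦ π(g⁻¹) j(f(g))`. -/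
def frobeniusTerm {K : Subgroup G} {σ : Representation k K W} (π : Representation k G V)
    (j : σ.IntertwiningMap (res π K)) (f : compactInd K σ) :
    Quotient (QuotientGroup.rightRel K) → V :=
  Quotient.lift (fun g : G => π g⁻¹ (j (f.1 g))) (by
    intro a b hab
    obtain ⟨x, rfl⟩ := QuotientGroup.rightRel_apply.1 hab |> fun h =>
      (⟨⟨b * a⁻¹, h⟩, by simp⟩ : ∃ x : K, x * a = b)
    show π a⁻¹ (j (f.1 a)) = π (x * a)⁻¹ (j (f.1 (x * a)))
    rw [f.2.1, j.isIntertwining]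
    simp [← Module.End.mul_apply, ← map_mul])

theorem finite_support_frobeniusTerm {K : Subgroup G} (hK : IsOpen (K : Set G))
    {σ : Representation k K W} (π : Representation k G V)
    (j : σ.IntertwiningMap (res π K)) (f : compactInd K σ) :
    (Function.support (frobeniusTerm π j f)).Finite := by
  let q : G → Quotient (QuotientGroup.rightRel K) := Quotient.mk _
  have hopen : ∀ c, IsOpen (q ⁻¹' {c}) := by
    intro c
    induction c using Quotient.inductionOn with
    | h a =>
      have : q ⁻¹' {Quotient.mk _ a} = (fun b => a * b⁻¹) ⁻¹' (K : Set G) := by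
        ext b
        exact Quotient.eq.trans QuotientGroup.rightRel_apply
      rw [this]
      exact hK.preimage (by fun_prop)
  obtain ⟨t, ht⟩ := f.2.2.2.isCompact.elim_finite_subcover (fun c => q ⁻¹' {c}) hopen
    (fun g _ => Set.mem_iUnion.2 ⟨q g, rfl⟩)
  refine t.finite_toSet.subset fun c hc => ?_
  induction c using Quotient.inductionOn with
  | h a =>
    have ha : f.1 a ≠ 0 := by
      intro h0
      apply hc
      show π a⁻¹ (j (f.1 a)) = 0
      rw [h0, map_zero, map_zero]
    obtain ⟨d, hd, had⟩ := Set.mem_iUnion₂.1 (ht (subset_tsupport _ ha))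
    have had' : Quotient.mk _ a = d := had
    rw [had']
    exact hd

/-- Frobenius reciprocity: the `G`-map `ι` from the compact induction of `σ` to `π` attached to a
`K`-map `j` from `σ` to `π`, given by `ι f = ∑_{g ∈ K \ G} π(g⁻¹) j(f(g))`. -/
def frobenius {K : Subgroup G} (hK : IsOpen (K : Set G)) {σ : Representation k K W}
    (π : Representation k G V) (j : σ.IntertwiningMap (res π K)) :
    (compactIndRep K σ).IntertwiningMap π where
  toFun f := ∑ᶠ x, frobeniusTerm π j f x
  map_add' f f' := by
    rw [← finsum_add_distrib (finite_support_frobeniusTerm hK π j f)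
      (finite_support_frobeniusTerm hK π j f')]
    refine finsum_congr fun x => ?_
    induction x using Quotient.inductionOn with
    | h a =>
      show π a⁻¹ (j (f.1 a + f'.1 a)) = _
      rw [map_add, map_add]; rfl
  map_smul' r f := by
    rw [RingHom.id_apply, smul_finsum]
    refine finsum_congr fun x => ?_
    induction x using Quotient.inductionOn with
    | h a =>
      show π a⁻¹ (j (r • f.1 a)) = _
      rw [map_smul, map_smul]; rfl
  isIntertwining' g := by
    refine LinearMap.ext fun f => ?_
    show ∑ᶠ x, frobeniusTerm π j (compactIndRep K σ g f) x = π g (∑ᶠ x, frobeniusTerm π j f x)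
    refine Eq.trans ?_ (AddMonoidHom.map_finsum (π g).toAddMonoidHom
      (finite_support_frobeniusTerm hK π j f)).symm
    let e : Quotient (QuotientGroup.rightRel K) ≃ Quotient (QuotientGroup.rightRel K) :=
      Quotient.congr (Equiv.mulRight g) (fun a b => by
        rw [QuotientGroup.rightRel_apply, QuotientGroup.rightRel_apply]; simp)
    refine finsum_eq_of_bijective e e.bijective fun x => ?_
    induction x using Quotient.inductionOn with
    | h a =>
      show π a⁻¹ (j (f.1 (a * g))) = π g (π (a * g)⁻¹ (j (f.1 (a * g))))
      simp [← Module.End.mul_apply, ← map_mul]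

end CompactInduction

/-! ### The Iwahori subrepresentation -/

section Iwahori

variable {F E : Type*} [Field F] [ValuativeRel F] [TopologicalSpace F]
  [IsNonarchimedeanLocalField F] [Field E] [ValuativeRel E] [TopologicalSpace E]
  [IsNonarchimedeanLocalField E] [Algebra F E] [ValuativeExtension F E]
  [Algebra.IsQuadraticExtension F E] {k V W : Type*} [Field k]
  [AddCommGroup V] [Module k V] [AddCommGroup W] [Module k W]

variable (c : E ≃ₐ[F] E) (ϖ : Fˣ) (i : Fin 2)

/-- The subspace of functions in the compact induction of `σ` that are supported in the double
coset `K αⁿ I_K`. For `n ≥ 0` this is `R⁺_n(σ)`, and for `n = -(m + 1) < 0` it is `R⁻_m(σ)`. It is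
stable under `I_K`. -/
def sphere (σ : Representation k (maxCompact c i) W) (n : ℤ) :
    Subrepresentation (res (compactIndRep (maxCompact c i) σ) (iwahori c i)) where
  toSubmodule :=
    { carrier := {f | ∀ g : U3 c, f.1 g ≠ 0 →
        g ∈ (maxCompact c i : Set (U3 c)) * {alpha c ϖ ^ n} * (iwahori c i : Set (U3 c))}
      zero_mem' := fun g h => absurd rfl h
      add_mem' := fun {f f'} hf hf' g h => by
        by_cases h0 : f.1 g = 0
        · refine hf' g fun h1 => h ?_
          show f.1 g + f'.1 g = 0
          rw [h0, h1, add_zero]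
        · exact hf g h0
      smul_mem' := fun r f hf g h => hf g fun h0 => h (by
        show r • f.1 g = 0
        rw [h0, smul_zero]) }
  apply_mem_toSubmodule x f hf g h := by
    obtain ⟨y, hy, z, hz, hyz⟩ := hf (g * x.1) h
    refine ⟨y, hy, z * x.1⁻¹, mul_mem hz (inv_mem x.2), ?_⟩
    show y * (z * x.1⁻¹) = g
    rw [← mul_assoc, show y * z = g * x.1 from hyz, mul_inv_cancel_right]

/-- `I⁺(σ) = ⨁_{n ≥ 0} R⁺_n(σ)`. -/
def posPart (σ : Representation k (maxCompact c i) W) :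
    Subrepresentation (res (compactIndRep (maxCompact c i) σ) (iwahori c i)) where
  toSubmodule := ⨆ n : ℕ, (sphere c ϖ i σ n).toSubmodule
  apply_mem_toSubmodule x := by
    have h : (⨆ n : ℕ, (sphere c ϖ i σ n).toSubmodule) ≤
        (⨆ n : ℕ, (sphere c ϖ i σ n).toSubmodule).comap
          (res (compactIndRep (maxCompact c i) σ) (iwahori c i) x) :=
      iSup_le fun n f hf =>
        Submodule.mem_iSup_of_mem n ((sphere c ϖ i σ n).apply_mem_toSubmodule x hf)
    exact fun v hv => h hv

/-- `I⁻(σ) = ⨁_{n ≥ 1} R⁻_{n-1}(σ)`. -/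
def negPart (σ : Representation k (maxCompact c i) W) :
    Subrepresentation (res (compactIndRep (maxCompact c i) σ) (iwahori c i)) where
  toSubmodule := ⨆ n : ℕ, (sphere c ϖ i σ (-(n + 1))).toSubmodule
  apply_mem_toSubmodule x := by
    have h : (⨆ n : ℕ, (sphere c ϖ i σ (-(n + 1))).toSubmodule) ≤
        (⨆ n : ℕ, (sphere c ϖ i σ (-(n + 1))).toSubmodule).comap
          (res (compactIndRep (maxCompact c i) σ) (iwahori c i) x) :=
      iSup_le fun n f hf =>
        Submodule.mem_iSup_of_mem n ((sphere c ϖ i σ (-(n + 1))).apply_mem_toSubmodule x hf)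
    exact fun v hv => h hv

variable {i} {σ : Representation k (maxCompact c i) W}

/-- The image in `π` of an `I_K`-subrepresentation of the compact induction of `σ`, under the
`G`-map attached to `j`. -/
def image (π : Representation k (U3 c) V) (j : σ.IntertwiningMap (res π (maxCompact c i)))
    (S : Subrepresentation (res (compactIndRep (maxCompact c i) σ) (iwahori c i))) :
    Subrepresentation (res π (iwahori c i)) where
  toSubmodule := S.toSubmodule.map (frobenius (isOpen_maxCompact c i) π j).toLinearMap
  apply_mem_toSubmodule x := by
    rintro _ ⟨f, hf, rfl⟩
    exact ⟨_, S.apply_mem_toSubmodule x hf,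
      (frobenius (isOpen_maxCompact c i) π j).isIntertwining _ _ x.1 f⟩

/-- The `I_K`-subrepresentation `I⁺(σ, π) ∩ I⁻(σ, π)` of `π`. -/
def iwahoriSubrep (π : Representation k (U3 c) V)
    (j : σ.IntertwiningMap (res π (maxCompact c i))) :
    Subrepresentation (res π (iwahori c i)) :=
  image c π j (posPart c ϖ i σ) ⊓ image c π j (negPart c ϖ i σ)

end Iwahori

end UnramifiedU3

end

open UnramifiedU3

noncomputable section

namespace UnramifiedU3

/-! ### Double cosets of an infinite dihedral Bruhat decomposition -/

section Cells

variable {G : Type*} [Group G]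

/-! Put `U = j(σ)`, `U' = j'(σ')`, and let `M` be the space of pro-`p` Iwahori invariants of `π`.
Frobenius reciprocity evaluates at inverses, so `I⁺(σ, π)` is the span `P(U)` of the translates of
`U` by `I α⁻ⁿ K` with `n ≥ 0`, and `I⁻(σ, π)` is the span `N(U)` of those by `I αⁿ K` with `n ≥ 1`
(`map_sphere`). Let `Pₘ(U)` be the part of `P(U)` with `n ≥ m`. The proof shows more than the claim:
`P(U') = P(U)` and `N(U') = N(U)` separately (`halfSpaces_eq`).

The group-theoretic input is a Bruhat decomposition with infinite dihedral Weyl group, generated by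
involutions `s ∈ K` and `s'` with `α = s' s` (`isDihedralDatum`, `exists_mem_cell`). It gives `K = I
∪ I s I` and the inclusions `s N(U) ⊆ P₁(U)`, `s' P(U) ⊆ N(U)`, `α⁻ᵐ Pₙ(U) ⊆ Pₙ₊ₘ(U)`. Only the
covering of `G` by the cells `I αⁿ K` matters, not their disjointness.

`P(U') ⊆ P(U)` (`posSpan_le_posSpan`): since `I₁` is pro-`p`, `U'` contains a nonzero `w ∈ M`. By
hypothesis `I w ⊆ M` lies in both half spaces of `U`, hence `I w` and `I s I w` lie in `P(U)`. These
span `U'`, and `P(U)` is stable under `I` and `α⁻¹`.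

`P(U) ⊆ P(U')`: first, `M ⊆ N(U)` forces `U ⊆ P₁(U)` (`le_posSpan_one`), and iterating gives `P(U) =
Pₘ(U)` for every `m`. Second, irreducibility of `π` puts a generator of `U` in a finite sum of
translates of `U'`, so a high power of `α⁻¹` pushes it into `P(U')`; thus `Pₘ(U) ⊆ P(U')` for large
`m` (`exists_posSpan_le_posSpan`).

Finally `N` is spanned by the `I`-translates of `s' P`, so equality of the positive half spaces
gives that of the negative ones.

The rest verifies the input for `U(2,1)`: an isotropic row or column, scaled to have an entry `1` at
one end, is a row or column of a unipotent element, and this drives every decomposition. Fixed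
vectors come from a filtration in which taking `p`-th powers raises the depth. -/

theorem mul_zpow_of_involutive {s s' α : G} (hα : α = s' * s) (hs : s * s = 1)
    (hs' : s' * s' = 1) (n : ℤ) : s * α ^ n = α ^ (-n) * s := by
  have h1 : s * α * s⁻¹ = α⁻¹ := by
    rw [hα, mul_inv_rev, inv_eq_of_mul_eq_one_left hs, inv_eq_of_mul_eq_one_left hs']
    simp only [mul_assoc, hs, mul_one]
  have h2 := conj_zpow (i := n) (a := s) (b := α)
  rw [h1] at h2
  rw [zpow_neg, ← inv_zpow, h2]
  group

/-- The double coset `I αⁿ K`. -/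
def cell (K I : Subgroup G) (α : G) (n : ℤ) : Set G :=
  {g | ∃ x ∈ I, ∃ y ∈ K, g = x * α ^ n * y}

/-- Subgroups `I ≤ K` of `G` and involutions `s ∈ K` and `s'` that satisfy the multiplication
rules of a Bruhat decomposition of `G` with infinite dihedral Weyl group, where `α = s' s`. -/
structure IsDihedralDatum (K I : Subgroup G) (s s' α : G) : Prop where
  le : I ≤ K
  s_mem : s ∈ K
  alpha_eq : α = s' * s
  s_sq : s * s = 1
  s'_sq : s' * s' = 1
  mem_or_of_mem : ∀ x ∈ K, x ∈ I ∨ ∃ a ∈ I, ∃ b ∈ I, x = a * s * b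
  conj_mem_or : ∀ x ∈ I, s' * x * s' ∈ I ∨ ∃ a ∈ I, ∃ b ∈ I, s' * x * s' = a * s' * b
  s_mul_mem : ∀ (n : ℕ), ∀ x ∈ I, s * x * α ^ (n : ℤ) ∈ cell K I α (-n)
  s'_mul_mem : ∀ (n : ℕ), ∀ x ∈ I, s' * x * α ^ (-n : ℤ) ∈ cell K I α (n + 1)

variable {K I : Subgroup G} {s s' α : G}

theorem mul_mem_cell {n : ℤ} {x g y : G} (hx : x ∈ I) (hg : g ∈ cell K I α n) (hy : y ∈ K) :
    x * g * y ∈ cell K I α n := by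
  obtain ⟨a, ha, b, hb, rfl⟩ := hg
  exact ⟨x * a, mul_mem hx ha, b * y, mul_mem hb hy, by group⟩

theorem left_mul_mem_cell {n : ℤ} {x g : G} (hx : x ∈ I) (hg : g ∈ cell K I α n) :
    x * g ∈ cell K I α n := by
  simpa using mul_mem_cell hx hg (one_mem K)

theorem right_mul_mem_cell {n : ℤ} {g y : G} (hg : g ∈ cell K I α n) (hy : y ∈ K) :
    g * y ∈ cell K I α n := by
  simpa using mul_mem_cell (one_mem I) hg hy

namespace IsDihedralDatum

variable (h : IsDihedralDatum K I s s' α)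

include h

theorem s_mul_cell (n : ℕ) {g : G} (hg : g ∈ cell K I α n) : s * g ∈ cell K I α (-n) := by
  obtain ⟨x, hx, y, hy, rfl⟩ := hg
  simpa only [mul_assoc] using right_mul_mem_cell (h.s_mul_mem n x hx) hy

theorem s'_mul_cell (n : ℕ) {g : G} (hg : g ∈ cell K I α (-n)) :
    s' * g ∈ cell K I α (n + 1) := by
  obtain ⟨x, hx, y, hy, rfl⟩ := hg
  simpa only [mul_assoc] using right_mul_mem_cell (h.s'_mul_mem n x hx) hy

/-- Since `α⁻ⁿ = s αⁿ s`, the product `s x α⁻ⁿ y` equals `(s x s) αⁿ (s y)` with `s x s ∈ K`. If `s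
x s` falls into `I s I`, the rule for nonnegative exponents applies once more. -/
theorem s_mul_cell_neg (n : ℕ) {g : G} (hg : g ∈ cell K I α (-n)) :
    s * g ∈ cell K I α n ∨ s * g ∈ cell K I α (-n) := by
  obtain ⟨x, hx, y, hy, rfl⟩ := hg
  have e : s * (x * α ^ (-n : ℤ) * y) = s * x * s * (α ^ (n : ℤ) * (s * y)) := by
    have := mul_zpow_of_involutive h.alpha_eq h.s_sq h.s'_sq n
    calc s * (x * α ^ (-n : ℤ) * y) = s * x * (α ^ (-n : ℤ) * (s * s)) * y := by
          rw [h.s_sq]; group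
      _ = s * x * ((α ^ (-n : ℤ) * s) * s) * y := by group
      _ = _ := by rw [← this]; group
  have hc : α ^ (n : ℤ) * (s * y) ∈ cell K I α n :=
    ⟨1, one_mem _, s * y, mul_mem h.s_mem hy, by group⟩
  rw [e]
  rcases h.mem_or_of_mem (s * x * s) (mul_mem (mul_mem h.s_mem (h.le hx)) h.s_mem) with
    hI | ⟨a, ha, b, hb, hab⟩
  · exact Or.inl (left_mul_mem_cell hI hc)
  · refine Or.inr ?_
    rw [hab]
    simpa only [mul_assoc] using
      left_mul_mem_cell ha (h.s_mul_cell n (left_mul_mem_cell hb hc))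

/-- The mirror image for `s'`: here `αⁿ⁺¹ = s' α⁻ⁿ s`, and `s' x s'` lies in `I` or in `I s' I`. -/
theorem s'_mul_cell_succ (n : ℕ) {g : G} (hg : g ∈ cell K I α (n + 1)) :
    s' * g ∈ cell K I α (-n) ∨ s' * g ∈ cell K I α (n + 1) := by
  obtain ⟨x, hx, y, hy, rfl⟩ := hg
  have e : s' * (x * α ^ (n + 1 : ℤ) * y) = s' * x * s' * (α ^ (-n : ℤ) * (s * y)) := by
    have h1 := mul_zpow_of_involutive h.alpha_eq h.s_sq h.s'_sq n
    have h2 : s' * (α * α ^ (n : ℤ)) = s * α ^ (n : ℤ) := by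
      nth_rewrite 1 [h.alpha_eq]
      rw [← mul_assoc, ← mul_assoc, h.s'_sq, one_mul]
    calc s' * (x * α ^ (n + 1 : ℤ) * y)
        = s' * x * ((s' * s') * (α * α ^ (n : ℤ))) * y := by rw [h.s'_sq]; group
      _ = s' * x * (s' * (s' * (α * α ^ (n : ℤ)))) * y := by group
      _ = _ := by rw [h2, h1]; group
  have hc : α ^ (-n : ℤ) * (s * y) ∈ cell K I α (-n) :=
    ⟨1, one_mem _, s * y, mul_mem h.s_mem hy, by group⟩
  rw [e]
  rcases h.conj_mem_or x hx with hI | ⟨a, ha, b, hb, hab⟩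
  · exact Or.inl (left_mul_mem_cell hI hc)
  · refine Or.inr ?_
    rw [hab]
    simpa only [mul_assoc] using
      left_mul_mem_cell ha (h.s'_mul_cell n (left_mul_mem_cell hb hc))

theorem alpha_mul (g : G) : α * g = s' * (s * g) := by
  rw [h.alpha_eq, mul_assoc]

theorem alpha_inv_mul (g : G) : α⁻¹ * g = s * (s' * g) := by
  have hs : s⁻¹ = s := inv_eq_of_mul_eq_one_left h.s_sq
  have hs' : s'⁻¹ = s' := inv_eq_of_mul_eq_one_left h.s'_sq
  rw [h.alpha_eq, mul_inv_rev, hs, hs', mul_assoc]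

theorem alpha_inv_mul_cell_neg (n : ℕ) {g : G} (hg : g ∈ cell K I α (-n)) :
    α⁻¹ * g ∈ cell K I α (-(n + 1)) := by
  rw [h.alpha_inv_mul]
  exact_mod_cast h.s_mul_cell (n + 1) (by exact_mod_cast h.s'_mul_cell n hg)

theorem alpha_zpow_neg_mul_cell_neg (m n : ℕ) {g : G} (hg : g ∈ cell K I α (-n)) :
    α ^ (-m : ℤ) * g ∈ cell K I α (-(n + m)) := by
  induction m with
  | zero => simpa using hg
  | succ m ih =>
    have := h.alpha_inv_mul_cell_neg (n + m) (by exact_mod_cast ih)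
    rw [← mul_assoc, ← zpow_neg_one, ← zpow_add] at this
    push_cast at this ⊢
    rw [show (-(m + 1) : ℤ) = -1 + -m by ring, show (-(n + (m + 1)) : ℤ) = -(n + m + 1) by ring]
    exact this

/-- Writing `α⁻¹ = s s'`, a positive index drops by at least one, while a nonpositive index stays
nonpositive. Hence `m` steps clear all indices up to `m`. -/
theorem alpha_inv_mul_cell_le (m : ℕ) {n : ℤ} (hn : n ≤ m + 1) {g : G}
    (hg : g ∈ cell K I α n) : ∃ n' : ℤ, n' ≤ m ∧ α⁻¹ * g ∈ cell K I α n' := by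
  rcases le_or_gt n 0 with h0 | h0
  · obtain ⟨n, rfl⟩ : ∃ n' : ℕ, n = -n' := ⟨n.natAbs, by omega⟩
    exact ⟨_, by omega, h.alpha_inv_mul_cell_neg n hg⟩
  · obtain ⟨n, rfl⟩ : ∃ n' : ℕ, n = n' + 1 := ⟨(n - 1).natAbs, by omega⟩
    rw [h.alpha_inv_mul]
    rcases h.s'_mul_cell_succ n hg with h1 | h1
    · rcases h.s_mul_cell_neg n h1 with h2 | h2
      · exact ⟨_, by omega, h2⟩
      · exact ⟨_, by omega, h2⟩
    · exact ⟨_, by omega, h.s_mul_cell (n + 1) (by exact_mod_cast h1)⟩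

theorem alpha_zpow_neg_mul_cell_le (m : ℕ) {n : ℤ} (hn : n ≤ m) {g : G}
    (hg : g ∈ cell K I α n) : ∃ n' : ℕ, α ^ (-m : ℤ) * g ∈ cell K I α (-n') := by
  induction m generalizing n g with
  | zero =>
    refine ⟨n.natAbs, ?_⟩
    rw [show (-(n.natAbs : ℤ)) = n by simp at hn; omega]
    simpa using hg
  | succ m ih =>
    obtain ⟨n', hn', h'⟩ := h.alpha_inv_mul_cell_le m (by exact_mod_cast hn) hg
    obtain ⟨n'', h''⟩ := ih hn' h'
    refine ⟨n'', ?_⟩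
    rw [← mul_assoc, ← zpow_neg_one, ← zpow_add] at h''
    push_cast
    rwa [neg_add]

/-- The union of the double cosets `I αⁿ K` with `|n| ≤ m` is stable under `K`. -/
theorem mul_cell_natAbs_le {x : G} (hx : x ∈ K) (m : ℕ) {n : ℤ} (hn : n.natAbs ≤ m) {g : G}
    (hg : g ∈ cell K I α n) : ∃ n' : ℤ, n'.natAbs ≤ m ∧ x * g ∈ cell K I α n' := by
  have hs : ∀ {n : ℤ}, n.natAbs ≤ m → ∀ {g : G}, g ∈ cell K I α n →
      ∃ n' : ℤ, n'.natAbs ≤ m ∧ s * g ∈ cell K I α n' := by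
    intro n hn g hg
    rcases le_or_gt n 0 with h0 | h0
    · obtain ⟨n, rfl⟩ : ∃ n' : ℕ, n = -n' := ⟨n.natAbs, by omega⟩
      rcases h.s_mul_cell_neg n hg with h1 | h1
      · exact ⟨_, by omega, h1⟩
      · exact ⟨_, by omega, h1⟩
    · obtain ⟨n, rfl⟩ : ∃ n' : ℕ, n = n' := ⟨n.natAbs, by omega⟩
      exact ⟨_, by omega, h.s_mul_cell n hg⟩
  rcases h.mem_or_of_mem x hx with hI | ⟨a, ha, b, hb, rfl⟩
  · exact ⟨n, hn, left_mul_mem_cell hI hg⟩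
  · obtain ⟨n', hn', h'⟩ := hs hn (left_mul_mem_cell hb hg)
    exact ⟨n', hn', by simpa only [mul_assoc] using left_mul_mem_cell ha h'⟩

theorem exists_mem_cell_s_mul {g : G} (hg : ∃ n, g ∈ cell K I α n) :
    ∃ n, s * g ∈ cell K I α n := by
  obtain ⟨n, hn⟩ := hg
  obtain ⟨n', -, h'⟩ := h.mul_cell_natAbs_le h.s_mem _ le_rfl hn
  exact ⟨n', h'⟩

theorem exists_mem_cell_s'_mul {g : G} (hg : ∃ n, g ∈ cell K I α n) :
    ∃ n, s' * g ∈ cell K I α n := by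
  obtain ⟨n, hn⟩ := hg
  rcases le_or_gt n 0 with h0 | h0
  · obtain ⟨n, rfl⟩ : ∃ n' : ℕ, n = -n' := ⟨n.natAbs, by omega⟩
    exact ⟨_, h.s'_mul_cell n hn⟩
  · obtain ⟨n, rfl⟩ : ∃ n' : ℕ, n = n' + 1 := ⟨(n - 1).natAbs, by omega⟩
    exact (h.s'_mul_cell_succ n hn).elim (fun h1 => ⟨_, h1⟩) fun h1 => ⟨_, h1⟩

theorem exists_mem_cell_zpow_mul {g : G} (hg : ∃ n, g ∈ cell K I α n) (m : ℤ) :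
    ∃ n, α ^ m * g ∈ cell K I α n := by
  induction m with
  | zero => simpa using hg
  | succ m ih =>
    rw [add_comm, zpow_one_add, mul_assoc, h.alpha_mul]
    exact h.exists_mem_cell_s'_mul (h.exists_mem_cell_s_mul ih)
  | pred m ih =>
    rw [sub_eq_neg_add, zpow_add, zpow_neg_one, mul_assoc, h.alpha_inv_mul]
    exact h.exists_mem_cell_s_mul (h.exists_mem_cell_s'_mul ih)

end IsDihedralDatum

end Cells

/-! ### Half spaces of a representation -/

section HalfSpaces

variable {k G V : Type*} [Field k] [Group G] [AddCommGroup V] [Module k V]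

/-- The span of the translates `g U` for `g ∈ A`. -/
def translateSpan (π : Representation k G V) (U : Submodule k V) (A : Set G) : Submodule k V :=
  Submodule.span k {v | ∃ g ∈ A, ∃ u ∈ U, π g u = v}

theorem apply_mem_translateSpan (π : Representation k G V) {U : Submodule k V} {A : Set G} {g : G}
    (hg : g ∈ A) {u : V} (hu : u ∈ U) : π g u ∈ translateSpan π U A :=
  Submodule.subset_span ⟨g, hg, u, hu, rfl⟩

theorem translateSpan_le {π : Representation k G V} {U N : Submodule k V} {A : Set G}
    (h : ∀ g ∈ A, ∀ u ∈ U, π g u ∈ N) : translateSpan π U A ≤ N := by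
  refine Submodule.span_le.2 ?_
  rintro _ ⟨g, hg, u, hu, rfl⟩
  exact h g hg u hu

theorem translateSpan_mono {π : Representation k G V} {U : Submodule k V} {A B : Set G}
    (h : A ⊆ B) : translateSpan π U A ≤ translateSpan π U B :=
  translateSpan_le fun _ hg _ hu => apply_mem_translateSpan π (h hg) hu

theorem map_mem_translateSpan (π : Representation k G V) {U : Submodule k V} {A B : Set G} (x : G)
    (h : ∀ g ∈ A, x * g ∈ B) {v : V} (hv : v ∈ translateSpan π U A) :
    π x v ∈ translateSpan π U B := by
  have : translateSpan π U A ≤ (translateSpan π U B).comap (π x) :=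
    translateSpan_le fun g hg u hu => by
      rw [Submodule.mem_comap, ← Module.End.mul_apply, ← map_mul]
      exact apply_mem_translateSpan π (h g hg) hu
  exact this hv

theorem translateSpan_iUnion {π : Representation k G V} {U : Submodule k V} {ι : Type*}
    (A : ι → Set G) : translateSpan π U (⋃ i, A i) = ⨆ i, translateSpan π U (A i) := by
  refine le_antisymm (translateSpan_le fun g hg u hu => ?_)
    (iSup_le fun i => translateSpan_mono (Set.subset_iUnion A i))
  obtain ⟨i, hi⟩ := Set.mem_iUnion.1 hg
  exact Submodule.mem_iSup_of_mem i (apply_mem_translateSpan π hi hu)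

/-- The span of the translates of `U` by the double cosets `I α⁻ⁿ K` for `n ≥ N`. -/
def posSpan (K I : Subgroup G) (α : G) (π : Representation k G V) (U : Submodule k V) (N : ℕ) :
    Submodule k V :=
  translateSpan π U {g | ∃ n : ℕ, N ≤ n ∧ g ∈ cell K I α (-n)}

/-- The span of the translates of `U` by the double cosets `I αⁿ K` for `n ≥ 1`. -/
def negSpan (K I : Subgroup G) (α : G) (π : Representation k G V) (U : Submodule k V) :
    Submodule k V :=
  translateSpan π U {g | ∃ n : ℕ, g ∈ cell K I α (n + 1)}

/-- A nonzero `K`-stable subspace without proper nonzero `K`-stable subspaces. -/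
structure IsIrreducibleFor (π : Representation k G V) (K : Subgroup G) (U : Submodule k V) :
    Prop where
  ne_bot : U ≠ ⊥
  apply_mem : ∀ x ∈ K, ∀ u ∈ U, π x u ∈ U
  le_of_stable : ∀ Y : Submodule k V, (∀ x ∈ K, ∀ y ∈ Y, π x y ∈ Y) → ∀ y ∈ Y, y ∈ U → y ≠ 0 →
    U ≤ Y

theorem IsIrreducibleFor.le_of_orbit_mem {π : Representation k G V} {K : Subgroup G}
    {U : Submodule k V} (h : IsIrreducibleFor π K U) {w : V} (hw : w ∈ U) (hw0 : w ≠ 0)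
    {N : Submodule k V} (hN : ∀ x ∈ K, π x w ∈ N) : U ≤ N := by
  let Y : Submodule k V := Submodule.span k {v | ∃ x ∈ K, π x w = v}
  refine (h.le_of_stable Y ?_ w (Submodule.subset_span ⟨1, one_mem K, by simp⟩) hw hw0).trans ?_
  · intro x hx
    have : Y ≤ Y.comap (π x) := by
      refine Submodule.span_le.2 ?_
      rintro _ ⟨z, hz, rfl⟩
      exact Submodule.subset_span ⟨x * z, mul_mem hx hz, by simp⟩
    exact fun y hy => this hy
  · refine Submodule.span_le.2 ?_
    rintro _ ⟨x, hx, rfl⟩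
    exact hN x hx

namespace IsDihedralDatum

variable {K I : Subgroup G} {s s' α : G} (h : IsDihedralDatum K I s s' α)
  {π : Representation k G V} {U U' M : Submodule k V}

omit h in
theorem posSpan_antitone {N N' : ℕ} (hN : N ≤ N') :
    posSpan K I α π U N' ≤ posSpan K I α π U N :=
  by
  refine translateSpan_mono ?_
  rintro _ ⟨n, hn, hg⟩
  exact ⟨n, hN.trans hn, hg⟩

omit h in
theorem apply_mem_posSpan {x : G} (hx : x ∈ I) {N : ℕ} {v : V} (hv : v ∈ posSpan K I α π U N) :
    π x v ∈ posSpan K I α π U N := by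
  refine map_mem_translateSpan π x ?_ hv
  rintro _ ⟨n, hn, hg⟩
  exact ⟨n, hn, left_mul_mem_cell hx hg⟩

omit h in
theorem apply_mem_negSpan {x : G} (hx : x ∈ I) {v : V} (hv : v ∈ negSpan K I α π U) :
    π x v ∈ negSpan K I α π U := by
  refine map_mem_translateSpan π x ?_ hv
  rintro _ ⟨n, hg⟩
  exact ⟨n, left_mul_mem_cell hx hg⟩

include h

theorem s_apply_mem_posSpan {v : V} (hv : v ∈ negSpan K I α π U) :
    π s v ∈ posSpan K I α π U 1 := by
  refine map_mem_translateSpan π s ?_ hv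
  rintro _ ⟨n, hg⟩
  exact ⟨n + 1, by omega, h.s_mul_cell (n + 1) (by exact_mod_cast hg)⟩

theorem s'_apply_mem_negSpan {v : V} (hv : v ∈ posSpan K I α π U 0) :
    π s' v ∈ negSpan K I α π U := by
  refine map_mem_translateSpan π s' ?_ hv
  rintro _ ⟨n, _, hg⟩
  exact ⟨n, h.s'_mul_cell n hg⟩

theorem alpha_zpow_apply_mem_posSpan (m : ℕ) {N : ℕ} {v : V} (hv : v ∈ posSpan K I α π U N) :
    π (α ^ (-m : ℤ)) v ∈ posSpan K I α π U (N + m) := by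
  refine map_mem_translateSpan π _ ?_ hv
  rintro _ ⟨n, hn, hg⟩
  exact ⟨n + m, by omega, by exact_mod_cast h.alpha_zpow_neg_mul_cell_neg m n hg⟩

omit h in
/-- `posSpan` is generated by the translates of a `K`-generator of `U`. -/
theorem posSpan_le_of_generator (hU : IsIrreducibleFor π K U) {w : V} (hw : w ∈ U) (hw0 : w ≠ 0)
    {N : ℕ} {P : Submodule k V} (hP : ∀ x ∈ I, ∀ v ∈ P, π x v ∈ P)
    (hPw : ∀ n : ℕ, N ≤ n → ∀ y ∈ K, π (α ^ (-n : ℤ)) (π y w) ∈ P) :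
    posSpan K I α π U N ≤ P := by
  refine translateSpan_le ?_
  rintro _ ⟨n, hn, x, hx, y, hy, rfl⟩ u hu
  rw [mul_assoc, map_mul, Module.End.mul_apply]
  refine hP x hx _ ?_
  rw [map_mul, Module.End.mul_apply]
  have hle : U ≤ P.comap (π (α ^ (-n : ℤ))) := hU.le_of_orbit_mem hw hw0 fun z hz => hPw n hn z hz
  exact hle (hU.apply_mem y hy u hu)

/-- The identity `αⁿ⁺¹ = s' α⁻ⁿ s` exhibits the negative half space as the span of the
`I`-translates of the image of the positive one under `s'`. -/
theorem negSpan_le_of_posSpan_le (hle : posSpan K I α π U' 0 ≤ posSpan K I α π U 0) :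
    negSpan K I α π U' ≤ negSpan K I α π U := by
  refine translateSpan_le ?_
  rintro _ ⟨n, x, hx, y, hy, rfl⟩ u hu
  have e : x * α ^ (n + 1 : ℤ) * y = x * (s' * (α ^ (-n : ℤ) * (s * y))) := by
    have h2 : s' * (α ^ (-n : ℤ) * s) = α ^ (n + 1 : ℤ) := by
      rw [← mul_zpow_of_involutive h.alpha_eq h.s_sq h.s'_sq, ← mul_assoc, ← h.alpha_eq, add_comm, zpow_add, zpow_one]
    rw [← h2]; group
  rw [e, map_mul, Module.End.mul_apply, map_mul, Module.End.mul_apply]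
  refine apply_mem_negSpan hx (h.s'_apply_mem_negSpan (hle ?_))
  exact apply_mem_translateSpan (A := {g | ∃ n : ℕ, 0 ≤ n ∧ g ∈ cell K I α (-n)}) π
    ⟨n, n.zero_le, 1, one_mem I, s * y, mul_mem h.s_mem hy, by group⟩ hu

/-- If a generator of `U'` lies in both half spaces of `U`, then the positive half space of `U'`
is contained in that of `U`. -/
theorem posSpan_le_posSpan (hU' : IsIrreducibleFor π K U') {w : V} (hw : w ∈ U') (hw0 : w ≠ 0)
    (hpos : ∀ x ∈ I, π x w ∈ posSpan K I α π U 0) (hneg : ∀ x ∈ I, π x w ∈ negSpan K I α π U) :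
    posSpan K I α π U' 0 ≤ posSpan K I α π U 0 := by
  refine posSpan_le_of_generator hU' hw hw0 (fun x hx v hv => apply_mem_posSpan hx hv) ?_
  intro n _ y hy
  refine posSpan_antitone (Nat.zero_le _) (h.alpha_zpow_apply_mem_posSpan n (N := 0) ?_)
  rcases h.mem_or_of_mem y hy with hI | ⟨a, ha, b, hb, rfl⟩
  · exact hpos y hI
  · rw [mul_assoc, map_mul, Module.End.mul_apply, map_mul, Module.End.mul_apply]
    exact apply_mem_posSpan ha (posSpan_antitone zero_le_one (h.s_apply_mem_posSpan (hneg b hb)))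

/-- If the vectors of `U` in `M` lie in the negative half space of `U`, then `U` is contained in
the span of its translates by the double cosets `I α⁻ⁿ K` with `n ≥ 1`. -/
theorem le_posSpan_one (hU : IsIrreducibleFor π K U) (hM : ∀ x ∈ I, ∀ v ∈ M, π x v ∈ M)
    (hfix : ∀ Y ≤ U, Y ≠ ⊥ → (∀ x ∈ I, ∀ y ∈ Y, π x y ∈ Y) → ∃ w ∈ Y, w ∈ M ∧ w ≠ 0)
    (hneg : M ≤ negSpan K I α π U) : U ≤ posSpan K I α π U 1 := by
  -- A generator in `M ⊓ U` alone would not do: its `I`-translates are only known to lie in the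
  -- positive half space at level `0`. The span of the translates of `s (M ⊓ U)` lies at level `1`,
  -- so it remains to see that it is all of `U`.
  let Y : Submodule k V := Submodule.span k {v | ∃ x ∈ I, ∃ m ∈ M ⊓ U, π x (π s m) = v}
  have hYI : ∀ x ∈ I, ∀ y ∈ Y, π x y ∈ Y := by
    intro x hx
    have : Y ≤ Y.comap (π x) := by
      refine Submodule.span_le.2 ?_
      rintro _ ⟨z, hz, m, hm, rfl⟩
      exact Submodule.subset_span ⟨x * z, mul_mem hx hz, m, hm, by simp⟩
    exact fun y hy => this hy
  have hYU : Y ≤ U := by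
    refine Submodule.span_le.2 ?_
    rintro _ ⟨z, hz, m, hm, rfl⟩
    exact hU.apply_mem _ (h.le hz) _ (hU.apply_mem _ h.s_mem _ hm.2)
  obtain ⟨m, hmU, hmM, hm0⟩ := hfix U le_rfl hU.ne_bot fun x hx => hU.apply_mem x (h.le hx)
  have hY0 : Y ≠ ⊥ := by
    intro h0
    have hm : π s m ∈ Y :=
      Submodule.subset_span ⟨1, one_mem _, m, ⟨hmM, hmU⟩, by simp⟩
    rw [h0, Submodule.mem_bot] at hm
    apply hm0
    have := congrArg (π s) hm
    rwa [← Module.End.mul_apply, ← map_mul, h.s_sq, map_one, map_zero] at this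
  obtain ⟨w, hwY, hwM, hw0⟩ := hfix Y hYU hY0 hYI
  -- The fixed vector `w` now lies in `Y` itself, so `I w ⊆ Y`; and `I s I w ⊆ Y` because `I w ⊆ M ⊓
  -- U`.
  have hUY : U ≤ Y := by
    refine hU.le_of_orbit_mem (hYU hwY) hw0 fun x hx => ?_
    rcases h.mem_or_of_mem x hx with hI | ⟨a, ha, b, hb, rfl⟩
    · exact hYI x hI w hwY
    · refine Submodule.subset_span ⟨a, ha, π b w, ⟨hM b hb w hwM, hYU (hYI b hb w hwY)⟩, ?_⟩
      simp
  refine hUY.trans (Submodule.span_le.2 ?_)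
  rintro _ ⟨z, hz, m, hm, rfl⟩
  exact apply_mem_posSpan hz (h.s_apply_mem_posSpan (hneg hm.1))

/-- Applying `α⁻ᵐ` to the hypothesis moves the contribution of the cell with exponent `-m` to level
`m + 1`; this can be repeated. -/
theorem posSpan_le_of_le_posSpan_one (hUK : ∀ x ∈ K, ∀ u ∈ U, π x u ∈ U)
    (hU : U ≤ posSpan K I α π U 1) (N : ℕ) : posSpan K I α π U 0 ≤ posSpan K I α π U N := by
  have step : ∀ n : ℕ, posSpan K I α π U n ≤ posSpan K I α π U (n + 1) := by
    intro n
    refine translateSpan_le ?_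
    rintro _ ⟨m, hm, x, hx, y, hy, rfl⟩ u hu
    rw [mul_assoc, map_mul, Module.End.mul_apply, map_mul, Module.End.mul_apply]
    exact apply_mem_posSpan hx (posSpan_antitone (by omega)
      (h.alpha_zpow_apply_mem_posSpan m (hU (hUK y hy u hu))))
  induction N with
  | zero => exact le_rfl
  | succ n ih => exact ih.trans (step n)

/-- Far enough translates of `U` lie in the positive half space of `U'`, provided that the
translates of `U'` span the whole space. -/
theorem exists_posSpan_le_posSpan (hcell : ∀ g, ∃ n, g ∈ cell K I α n) (hU : IsIrreducibleFor π K U)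
    (hU' : translateSpan π U' Set.univ = ⊤) :
    ∃ N, posSpan K I α π U N ≤ posSpan K I α π U' 0 := by
  obtain ⟨w, hw, hw0⟩ := Submodule.exists_mem_ne_zero_of_ne_bot hU.ne_bot
  -- An exhaustion of `G` by increasing `K`-stable unions of cells: a single vector already lies in
  -- the span for one of them, and its whole `K`-orbit stays there.
  let B : ℕ → Set G := fun m => {g | ∃ n : ℤ, n.natAbs ≤ m ∧ g ∈ cell K I α n}
  have hB : ⋃ m, B m = Set.univ := by
    refine Set.eq_univ_of_forall fun g => ?_
    obtain ⟨n, hn⟩ := hcell g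
    exact Set.mem_iUnion.2 ⟨n.natAbs, n, le_rfl, hn⟩
  have hdir : Directed (· ≤ ·) fun m => translateSpan π U' (B m) := by
    refine Monotone.directed_le fun m m' hm => translateSpan_mono ?_
    rintro _ ⟨n, hn, hg⟩
    exact ⟨n, hn.trans hm, hg⟩
  have hwtop : w ∈ ⨆ m, translateSpan π U' (B m) := by
    rw [← translateSpan_iUnion, hB, hU']; trivial
  obtain ⟨N, hN⟩ := (Submodule.mem_iSup_of_directed _ hdir).1 hwtop
  refine ⟨N, posSpan_le_of_generator hU hw hw0 (fun x hx v hv => apply_mem_posSpan hx hv) ?_⟩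
  intro n hn y hy
  have hy' : π y w ∈ translateSpan π U' (B N) := by
    refine map_mem_translateSpan π y ?_ hN
    rintro _ ⟨m, hm, hg⟩
    exact h.mul_cell_natAbs_le hy N hm hg
  refine map_mem_translateSpan π _ ?_ hy'
  rintro _ ⟨m, hm, hg⟩
  obtain ⟨n', hn'⟩ := h.alpha_zpow_neg_mul_cell_le n (show m ≤ n by omega) hg
  exact ⟨n', n'.zero_le, hn'⟩

/-- The half spaces of `U` do not depend on `U` if those of one `U` contain `M`. -/
theorem halfSpaces_eq (hcell : ∀ g, ∃ n, g ∈ cell K I α n) (hM : ∀ x ∈ I, ∀ v ∈ M, π x v ∈ M)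
    (hU : IsIrreducibleFor π K U) (hU' : IsIrreducibleFor π K U')
    (hfix : ∀ Y ≤ U, Y ≠ ⊥ → (∀ x ∈ I, ∀ y ∈ Y, π x y ∈ Y) → ∃ w ∈ Y, w ∈ M ∧ w ≠ 0)
    (hfix' : ∃ w ∈ U', w ∈ M ∧ w ≠ 0)
    (htop : translateSpan π U' Set.univ = ⊤)
    (hsub : M ≤ posSpan K I α π U 0 ⊓ negSpan K I α π U) :
    posSpan K I α π U' 0 = posSpan K I α π U 0 ∧ negSpan K I α π U' = negSpan K I α π U := by
  obtain ⟨w, hw, hwM, hw0⟩ := hfix'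
  have h1 : posSpan K I α π U' 0 ≤ posSpan K I α π U 0 :=
    h.posSpan_le_posSpan hU' hw hw0 (fun x hx => (hsub (hM x hx w hwM)).1)
      fun x hx => (hsub (hM x hx w hwM)).2
  have h2 : posSpan K I α π U 0 ≤ posSpan K I α π U' 0 := by
    obtain ⟨N, hN⟩ := h.exists_posSpan_le_posSpan hcell hU htop
    exact (h.posSpan_le_of_le_posSpan_one hU.apply_mem
      (h.le_posSpan_one hU hM hfix (hsub.trans inf_le_right)) N).trans hN
  exact ⟨le_antisymm h1 h2, le_antisymm (h.negSpan_le_of_posSpan_le h1)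
    (h.negSpan_le_of_posSpan_le h2)⟩

end IsDihedralDatum

end HalfSpaces

/-! ### Powers of the maximal ideal -/

section Powers

variable {E : Type*} [Field E] [ValuativeRel E] [TopologicalSpace E]
  [IsNonarchimedeanLocalField E]

/-- `x` lies in the fractional ideal `𝔭ⁿ`. -/
def PowMem (n : ℤ) (x : E) : Prop := valuation E x ≤ uniformizer E ^ n

namespace PowMem

variable {m n : ℤ} {x y : E}

theorem of_le (h : m ≤ n) (hx : PowMem n x) : PowMem m x :=
  hx.trans (zpow_le_zpow_right_of_le_one₀ uniformizer_pos uniformizer_lt_one.le h)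

theorem zero (n : ℤ) : PowMem n (0 : E) := by simp [PowMem]

theorem one (h : n ≤ 0) : PowMem n (1 : E) := of_le h (by simp [PowMem])

theorem add (hx : PowMem n x) (hy : PowMem n y) : PowMem n (x + y) :=
  (Valuation.map_add _ _ _).trans (max_le hx hy)

theorem neg (hx : PowMem n x) : PowMem n (-x) := by
  rwa [PowMem, Valuation.map_neg]

theorem sub (hx : PowMem n x) (hy : PowMem n y) : PowMem n (x - y) := by
  rw [sub_eq_add_neg]; exact hx.add hy.neg

theorem mul (hx : PowMem m x) (hy : PowMem n y) : PowMem (m + n) (x * y) := by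
  rw [PowMem, map_mul, zpow_add₀ uniformizer_ne_zero]
  exact mul_le_mul' hx hy

theorem mul' {l : ℤ} (hx : PowMem m x) (hy : PowMem n y) (h : l ≤ m + n) : PowMem l (x * y) :=
  of_le h (hx.mul hy)

end PowMem

variable {m n : ℤ} {x y : E}

theorem zpow_le_zpow_uniformizer_iff :
    uniformizer E ^ m ≤ uniformizer E ^ n ↔ n ≤ m :=
  zpow_le_zpow_iff_right_of_lt_one₀ uniformizer_pos uniformizer_lt_one

/-- Discreteness of the valuation: there is no value strictly between consecutive powers of the
uniformizer. -/
theorem le_valuation_of_not_powMem (h : ¬ PowMem (n + 1) x) : uniformizer E ^ n ≤ valuation E x := by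
  by_contra! hlt
  have h0 : (0 : ValueGroupWithZero E) < uniformizer E ^ n := zpow_pos uniformizer_pos n
  have h1 : valuation E x / uniformizer E ^ n ≤ uniformizer E :=
    le_uniformizer_iff.2 ((div_lt_one₀ h0).2 hlt)
  rw [div_le_iff₀ h0, ← zpow_one_add₀ uniformizer_ne_zero, add_comm] at h1
  exact h h1

theorem ne_zero_of_le_valuation (h : uniformizer E ^ n ≤ valuation E x) : x ≠ 0 := by
  rintro rfl
  rw [map_zero] at h
  exact (zpow_pos uniformizer_pos n).not_ge h

theorem PowMem.div (hx : PowMem m x) (hy : uniformizer E ^ n ≤ valuation E y) :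
    PowMem (m - n) (x / y) := by
  rw [PowMem, map_div₀, zpow_sub₀ uniformizer_ne_zero]
  exact div_le_div₀ (zpow_pos uniformizer_pos _).le hx (zpow_pos uniformizer_pos _) hy

theorem PowMem.le_of_le_valuation (hx : PowMem m x) (hy : uniformizer E ^ n ≤ valuation E x) :
    m ≤ n := zpow_le_zpow_uniformizer_iff.1 (hy.trans hx)

theorem exists_valuation_eq_zpow (hx : x ≠ 0) : ∃ n : ℤ, valuation E x = uniformizer E ^ n := by
  have h0 : 0 < valuation E x := zero_lt_iff.2 ((valuation E).ne_zero_iff.2 hx)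
  obtain ⟨n, hn, hn'⟩ : ∃ n : ℤ, uniformizer E ^ (n + 1) < valuation E x ∧
      valuation E x ≤ uniformizer E ^ n := by
    -- The uniformizer has value less than `1`, so the Archimedean statement for a base greater than
    -- `1` is applied to inverses.
    have hu : 1 < (Units.mk0 (uniformizer E) uniformizer_ne_zero)⁻¹ := by
      rw [one_lt_inv', ← Units.val_lt_val]
      exact uniformizer_lt_one
    obtain ⟨n, ⟨h1, h2⟩, -⟩ := existsUnique_zpow_near_of_one_lt hu (Units.mk0 _ h0.ne')⁻¹
    rw [inv_zpow, inv_le_inv_iff, ← Units.val_le_val] at h1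
    rw [inv_zpow, inv_lt_inv_iff, ← Units.val_lt_val] at h2
    exact ⟨n, by simpa using h2, by simpa using h1⟩
  exact ⟨n, le_antisymm hn' (le_valuation_of_not_powMem hn.not_ge)⟩

theorem exists_powMem (x : E) : ∃ N : ℤ, PowMem N x := by
  by_cases hx : x = 0
  · exact ⟨0, hx ▸ PowMem.zero 0⟩
  · obtain ⟨n, hn⟩ := exists_valuation_eq_zpow hx
    exact ⟨n, hn.le⟩

theorem powMem_zpow_mul_iff {t : E} (ht : valuation E t = uniformizer E) (k : ℤ) :
    PowMem n (t ^ k * x) ↔ PowMem (n - k) x := by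
  rw [PowMem, PowMem, map_mul, map_zpow₀, ht, zpow_sub₀ uniformizer_ne_zero,
    le_div_iff₀ (zpow_pos uniformizer_pos _), mul_comm]

theorem le_valuation_zpow_mul_iff {t : E} (ht : valuation E t = uniformizer E) (k : ℤ) :
    uniformizer E ^ n ≤ valuation E (t ^ k * x) ↔ uniformizer E ^ (n - k) ≤ valuation E x := by
  rw [map_mul, map_zpow₀, ht, zpow_sub₀ uniformizer_ne_zero,
    div_le_iff₀ (zpow_pos uniformizer_pos _), mul_comm]

end Powers

/-! ### Matrices in the unitary group -/

section Matrices

variable {F E : Type*} [Field F] [Field E] [Algebra F E]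

/-- A non-fixed `x` satisfies `x + c x ∈ F`, and applying `c` to this trace gives the claim. -/
theorem conj_conj [Algebra.IsQuadraticExtension F E] (c : E ≃ₐ[F] E) (x : E) : c (c x) = x := by
  obtain ⟨t, n, h⟩ := exists_quadratic_relation (F := F) x
  rcases conj_eq_or c h with h | h
  · rw [h, h]
  · have := congrArg c h
    rw [AlgEquiv.commutes, h, map_add] at this
    linear_combination -this

variable {c : E ≃ₐ[F] E}

theorem U3.mul_apply (g h : U3 c) (a b : Fin 3) :
    (g * h).1.1 a b = g.1.1 a 0 * h.1.1 0 b + g.1.1 a 1 * h.1.1 1 b + g.1.1 a 2 * h.1.1 2 b := by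
  rw [Subgroup.coe_mul, Units.val_mul, Matrix.mul_apply, Fin.sum_univ_three]

/-- The rows of a unitary matrix form a hyperbolic basis. -/
theorem U3.row_rel (g : U3 c) (a b : Fin 3) :
    g.1.1 a 0 * c (g.1.1 b 2) + g.1.1 a 1 * c (g.1.1 b 1) + g.1.1 a 2 * c (g.1.1 b 0) =
      if (a : ℕ) + b = 2 then 1 else 0 := by
  have h : (g * g⁻¹).1.1 a b.rev = (1 : Matrix (Fin 3) (Fin 3) E) a b.rev := by
    rw [mul_inv_cancel]; rfl
  rw [U3.mul_apply, U3.inv_apply, U3.inv_apply, U3.inv_apply, Fin.rev_rev] at h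
  refine h.trans ?_
  rw [Matrix.one_apply]
  exact if_congr (by simp only [Fin.ext_iff, Fin.val_rev]; omega) rfl rfl

/-- The columns of a unitary matrix form a hyperbolic basis. -/
theorem U3.col_rel (g : U3 c) (a b : Fin 3) :
    g.1.1 0 a * c (g.1.1 2 b) + g.1.1 1 a * c (g.1.1 1 b) + g.1.1 2 a * c (g.1.1 0 b) =
      if (a : ℕ) + b = 2 then 1 else 0 := by
  have h := g.2 (Pi.single a 1) (Pi.single b 1)
  rw [herm_single_left, herm_eq] at h
  simp only [Matrix.mulVec_single_one, Matrix.col_apply] at h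
  rw [h]
  rw [Pi.single_apply, apply_ite c, map_one, map_zero]
  exact if_congr (by simp only [Fin.ext_iff, Fin.val_rev]; omega) rfl rfl

/-- A unitary matrix whose last row is `(0, 0, *)` is upper triangular. -/
theorem U3.upper_of_row (g : U3 c) (h0 : g.1.1 2 0 = 0) (h1 : g.1.1 2 1 = 0) :
    g.1.1 1 0 = 0 := by
  have h2 : g.1.1 2 2 ≠ 0 := by
    intro h2
    have := U3.row_rel g 2 0
    simp [h0, h1, h2] at this
  have := U3.row_rel g 1 2
  simpa [h0, h1, h2] using this

/-- A unitary matrix whose first column is `(*, 0, 0)` is upper triangular. -/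
theorem U3.upper_of_col (g : U3 c) (h0 : g.1.1 1 0 = 0) (h1 : g.1.1 2 0 = 0) :
    g.1.1 2 1 = 0 := by
  have h2 : g.1.1 0 0 ≠ 0 := by
    intro h2
    have := U3.col_rel g 0 2
    simp [h0, h1, h2] at this
  have := U3.col_rel g 1 0
  simpa [h0, h1, h2] using this

/-- The antidiagonal element `antidiag(t⁻ᵐ, 1, tᵐ)`. -/
def weyl (c : E ≃ₐ[F] E) (t : Fˣ) (m : ℤ) : U3 c :=
  have h : algebraMap F E t ≠ 0 := by simp
  have h1 : !![0, 0, algebraMap F E t ^ (-m); 0, 1, 0; algebraMap F E t ^ m, 0, 0] *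
      !![0, 0, algebraMap F E t ^ (-m); 0, 1, 0; algebraMap F E t ^ m, 0, 0] =
      (1 : Matrix (Fin 3) (Fin 3) E) := by
    ext a b
    fin_cases a <;> fin_cases b <;> simp [Matrix.mul_apply, Fin.sum_univ_three,
      inv_mul_cancel₀ (zpow_ne_zero m h), mul_inv_cancel₀ (zpow_ne_zero m h)]
  ⟨⟨_, _, h1, h1⟩, fun v w => by
    simp [herm_eq, dotProduct, Fin.sum_univ_three]
    field_simp
    ring⟩

theorem weyl_val (t : Fˣ) (m : ℤ) : (weyl c t m).1.1 =
    !![0, 0, algebraMap F E t ^ (-m); 0, 1, 0; algebraMap F E t ^ m, 0, 0] := rfl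

theorem weyl_mul_self (t : Fˣ) (m : ℤ) : weyl c t m * weyl c t m = 1 := by
  have h : algebraMap F E t ≠ 0 := by simp
  refine Subtype.ext (Units.ext ?_)
  ext a b
  rw [U3.mul_apply, weyl_val]
  fin_cases a <;> fin_cases b <;>
    simp [inv_mul_cancel₀ (zpow_ne_zero m h), mul_inv_cancel₀ (zpow_ne_zero m h)]

theorem alpha_eq_weyl_mul (t : Fˣ) (m : ℤ) : alpha c t = weyl c t (m + 1) * weyl c t m := by
  have h : algebraMap F E t ≠ 0 := by simp
  refine Subtype.ext (Units.ext ?_)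
  ext a b
  rw [U3.mul_apply, weyl_val, weyl_val]
  fin_cases a <;> fin_cases b <;> simp [alpha, zpow_add₀ h] <;> field_simp

theorem alpha_zpow_val (t : Fˣ) (n : ℤ) : (alpha c t ^ n).1.1 =
    Matrix.diagonal ![algebraMap F E t ^ (-n), 1, algebraMap F E t ^ n] := by
  have h : algebraMap F E t ≠ 0 := by simp
  have h1 : ∀ n : ℕ, (alpha c t ^ n).1.1 =
      Matrix.diagonal ![algebraMap F E t ^ (-n : ℤ), 1, algebraMap F E t ^ n] := by
    intro n
    have : (alpha c t).1.1 = Matrix.diagonal ![(algebraMap F E t)⁻¹, 1, algebraMap F E t] := rfl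
    rw [Subgroup.coe_pow, Units.val_pow_eq_pow_val, this, Matrix.diagonal_pow]
    congr 1
    funext a
    fin_cases a <;> simp
  rcases n with n | n
  · simpa using h1 n
  · ext a b
    rw [zpow_negSucc, U3.inv_apply, h1]
    fin_cases a <;> fin_cases b <;> simp [Fin.rev, Matrix.diagonal, Int.negSucc_eq]
    all_goals norm_cast

theorem alpha_zpow_mul_apply (t : Fˣ) (n : ℤ) (g : U3 c) (a b : Fin 3) :
    (alpha c t ^ n * g).1.1 a b =
      ![algebraMap F E t ^ (-n), 1, algebraMap F E t ^ n] a * g.1.1 a b := by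
  rw [Subgroup.coe_mul, Units.val_mul, alpha_zpow_val, Matrix.diagonal_mul]

theorem mul_alpha_zpow_apply (t : Fˣ) (n : ℤ) (g : U3 c) (a b : Fin 3) :
    (g * alpha c t ^ n).1.1 a b =
      g.1.1 a b * ![algebraMap F E t ^ (-n), 1, algebraMap F E t ^ n] b := by
  rw [Subgroup.coe_mul, Units.val_mul, alpha_zpow_val, Matrix.mul_diagonal]

/-- Conjugation by `αⁿ` multiplies the `(a, b)` entry by `t ^ (n (a - b))`. -/
theorem alpha_zpow_conj_apply (t : Fˣ) (n : ℤ) (g : U3 c) (a b : Fin 3) :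
    (alpha c t ^ n * g * alpha c t ^ (-n)).1.1 a b =
      algebraMap F E t ^ (n * ((a : ℤ) - b)) * g.1.1 a b := by
  have h : algebraMap F E t ≠ 0 := by simp
  rw [mul_alpha_zpow_apply, alpha_zpow_mul_apply]
  fin_cases a <;> fin_cases b <;> simp [mul_two, zpow_add₀ h] <;> field_simp

theorem weyl_mul_apply (t : Fˣ) (m : ℤ) (g : U3 c) (a b : Fin 3) :
    (weyl c t m * g).1.1 a b = algebraMap F E t ^ (m * ((a : ℤ) - 1)) * g.1.1 a.rev b := by
  rw [U3.mul_apply, weyl_val]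
  fin_cases a <;> simp [Fin.rev]

theorem mul_weyl_apply (t : Fˣ) (m : ℤ) (g : U3 c) (a b : Fin 3) :
    (g * weyl c t m).1.1 a b = algebraMap F E t ^ (m * (1 - (b : ℤ))) * g.1.1 a b.rev := by
  rw [U3.mul_apply, weyl_val]
  fin_cases b <;> simp [Fin.rev, mul_comm]

/-- Conjugation by a Weyl element reverses the indices. -/
theorem weyl_conj_apply (t : Fˣ) (m : ℤ) (g : U3 c) (a b : Fin 3) :
    (weyl c t m * g * weyl c t m).1.1 a b =
      algebraMap F E t ^ (m * ((a : ℤ) - b)) * g.1.1 a.rev b.rev := by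
  have h : algebraMap F E t ≠ 0 := by simp
  rw [mul_weyl_apply, weyl_mul_apply, ← mul_assoc, ← zpow_add₀ h]
  congr 2
  ring

variable [Algebra.IsQuadraticExtension F E]

/-- The upper triangular unipotent element with last column `(y, z, 1)`. -/
def upperUnip (c : E ≃ₐ[F] E) (z y : E) (h : y + c y + z * c z = 0) : U3 c :=
  ⟨⟨!![1, -c z, y; 0, 1, z; 0, 0, 1], !![1, c z, c y; 0, 1, -z; 0, 0, 1],
    by
      ext a b
      fin_cases a <;> fin_cases b <;> simp [Matrix.mul_apply, Fin.sum_univ_three]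
      linear_combination h,
    by
      ext a b
      fin_cases a <;> fin_cases b <;> simp [Matrix.mul_apply, Fin.sum_univ_three]
      linear_combination h⟩,
    fun v w => by
      simp [herm_eq, dotProduct, Fin.sum_univ_three, conj_conj]
      linear_combination v 2 * c (w 2) * h⟩

/-- The lower triangular unipotent element with first column `(1, z, y)`. -/
def lowerUnip (c : E ≃ₐ[F] E) (z y : E) (h : y + c y + z * c z = 0) : U3 c :=
  ⟨⟨!![1, 0, 0; z, 1, 0; y, -c z, 1], !![1, 0, 0; -z, 1, 0; c y, c z, 1],
    by
      ext a b
      fin_cases a <;> fin_cases b <;> simp [Matrix.mul_apply, Fin.sum_univ_three]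
      linear_combination h,
    by
      ext a b
      fin_cases a <;> fin_cases b <;> simp [Matrix.mul_apply, Fin.sum_univ_three]
      linear_combination h⟩,
    fun v w => by
      simp [herm_eq, dotProduct, Fin.sum_univ_three, conj_conj]
      linear_combination v 0 * c (w 0) * h⟩

theorem upperUnip_val (z y : E) (h : y + c y + z * c z = 0) :
    (upperUnip c z y h).1.1 = !![1, -c z, y; 0, 1, z; 0, 0, 1] := rfl

theorem upperUnip_inv_val (z y : E) (h : y + c y + z * c z = 0) :
    (upperUnip c z y h)⁻¹.1.1 = !![1, c z, c y; 0, 1, -z; 0, 0, 1] := rfl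

theorem lowerUnip_val (z y : E) (h : y + c y + z * c z = 0) :
    (lowerUnip c z y h).1.1 = !![1, 0, 0; z, 1, 0; y, -c z, 1] := rfl

theorem lowerUnip_inv_val (z y : E) (h : y + c y + z * c z = 0) :
    (lowerUnip c z y h)⁻¹.1.1 = !![1, 0, 0; -z, 1, 0; c y, c z, 1] := rfl

omit [Algebra.IsQuadraticExtension F E] in
/-- The isotropy relation for a vector that is scaled to have a coordinate `1`. -/
theorem isotropic_div {x y z : E} (hz : z ≠ 0) (h : x * c z + y * c y + z * c x = 0) :
    x / z + c (x / z) + y / z * c (y / z) = 0 := by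
  have hcz : c z ≠ 0 := by simpa using hz
  rw [map_div₀, map_div₀]
  field_simp
  linear_combination h

end Matrices

/-! ### The Bruhat decomposition of the unitary group -/

section Bruhat

variable {F E : Type*} [Field F] [ValuativeRel F] [TopologicalSpace F]
  [IsNonarchimedeanLocalField F] [Field E] [ValuativeRel E] [TopologicalSpace E]
  [IsNonarchimedeanLocalField E] [Algebra F E] [ValuativeExtension F E]
  [Algebra.IsQuadraticExtension F E] {c : E ≃ₐ[F] E} {i : Fin 2}

theorem powMem_conj {n : ℤ} {x : E} : PowMem n (c x) ↔ PowMem n x := by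
  rw [PowMem, PowMem, valuation_conj]

/-- The norm `y * c y` has twice the order of `y`, and that order is an integer. The `+ 1` in `hl`
is the resulting rounding up of `n / 2`. -/
theorem powMem_of_mul_conj {l n : ℤ} {y : E} (h : PowMem n (y * c y)) (hl : 2 * l ≤ n + 1) :
    PowMem l y := by
  by_contra hy
  have h1 := le_valuation_of_not_powMem (n := l - 1) (by simpa using hy)
  have h2 : uniformizer E ^ ((l - 1) + (l - 1)) ≤ valuation E (y * c y) := by
    rw [map_mul, valuation_conj, zpow_add₀ uniformizer_ne_zero]
    exact mul_le_mul' h1 h1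
  have := h.le_of_le_valuation h2
  omega

/-- For an isotropic vector the norm of the middle coordinate is minus the trace of `x * c z`, so
the outer coordinates control the middle one. -/
theorem powMem_of_isotropic {l m n : ℤ} {x y z : E} (h : x * c z + y * c y + z * c x = 0)
    (hx : PowMem m x) (hz : PowMem n z) (hl : 2 * l ≤ m + n + 1) : PowMem l y := by
  refine powMem_of_mul_conj (c := c) (n := m + n) ?_ hl
  have : y * c y = -(x * c z) - z * c x := by linear_combination h
  rw [this]
  exact (hx.mul (powMem_conj.2 hz)).neg.sub ((hz.mul (powMem_conj.2 hx)).of_le (by omega))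

theorem compactExponent_eq (i : Fin 2) :
    compactExponent i = !![0, 0, -(i : ℤ); (i : ℤ), 0, 0; (i : ℤ), (i : ℤ), 0] := by
  fin_cases i <;> rfl

theorem iwahoriExponent_eq (i : Fin 2) :
    iwahoriExponent i = !![0, 0, -(i : ℤ); 1, 0, 0; 1 + (i : ℤ), 1, 0] := by
  fin_cases i <;> rfl

theorem mem_maxCompact_iff {g : U3 c} : g ∈ maxCompact c i ↔
    (PowMem 0 (g.1.1 0 0) ∧ PowMem 0 (g.1.1 0 1) ∧ PowMem (-(i : ℤ)) (g.1.1 0 2)) ∧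
    (PowMem i (g.1.1 1 0) ∧ PowMem 0 (g.1.1 1 1) ∧ PowMem 0 (g.1.1 1 2)) ∧
    (PowMem i (g.1.1 2 0) ∧ PowMem i (g.1.1 2 1) ∧ PowMem 0 (g.1.1 2 2)) := by
  have : g ∈ maxCompact c i ↔ ∀ a b, PowMem (compactExponent i a b) (g.1.1 a b) := Iff.rfl
  rw [this, compactExponent_eq]
  simp [Fin.forall_fin_succ]

theorem mem_iwahori_iff {g : U3 c} : g ∈ iwahori c i ↔
    (PowMem 0 (g.1.1 0 0) ∧ PowMem 0 (g.1.1 0 1) ∧ PowMem (-(i : ℤ)) (g.1.1 0 2)) ∧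
    (PowMem 1 (g.1.1 1 0) ∧ PowMem 0 (g.1.1 1 1) ∧ PowMem 0 (g.1.1 1 2)) ∧
    (PowMem (1 + i : ℤ) (g.1.1 2 0) ∧ PowMem 1 (g.1.1 2 1) ∧ PowMem 0 (g.1.1 2 2)) := by
  have : g ∈ iwahori c i ↔ ∀ a b, PowMem (iwahoriExponent i a b) (g.1.1 a b) := Iff.rfl
  rw [this, iwahoriExponent_eq]
  simp [Fin.forall_fin_succ]

theorem natCast_le_one (i : Fin 2) : ((i : ℕ) : ℤ) ≤ 1 := by omega

theorem iwahori_le_maxCompact : iwahori c i ≤ maxCompact c i := by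
  intro g hg
  rw [mem_iwahori_iff] at hg
  obtain ⟨⟨h00, h01, h02⟩, ⟨h10, h11, h12⟩, h20, h21, h22⟩ := hg
  have := natCast_le_one i
  exact mem_maxCompact_iff.2 ⟨⟨h00, h01, h02⟩, ⟨h10.of_le this, h11, h12⟩,
    h20.of_le (by omega), h21.of_le this, h22⟩

/-- An element of `K` whose lower left entry lies in `𝔭 ^ (1 + i)` lies in `I`. -/
theorem mem_iwahori_of_mem_maxCompact {g : U3 c} (hg : g ∈ maxCompact c i)
    (h20 : PowMem (1 + i : ℤ) (g.1.1 2 0)) : g ∈ iwahori c i := by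
  obtain ⟨⟨h00, h01, h02⟩, ⟨-, h11, h12⟩, -, -, h22⟩ := mem_maxCompact_iff.1 hg
  have hrow := U3.row_rel g 2 2
  have hcol := U3.col_rel g 0 0
  norm_num at hrow hcol
  exact mem_iwahori_iff.2 ⟨⟨h00, h01, h02⟩,
    ⟨powMem_of_isotropic hcol h00 h20 (by omega), h11, h12⟩,
    h20, powMem_of_isotropic hrow h20 h22 (by omega), h22⟩

theorem mem_iwahori_of_upper {g : U3 c} (hg : g ∈ maxCompact c i) (h20 : g.1.1 2 0 = 0) :
    g ∈ iwahori c i :=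
  mem_iwahori_of_mem_maxCompact hg (by rw [h20]; exact PowMem.zero _)

variable {ϖ : Fˣ} (hϖ : valuation E (algebraMap F E ϖ) = uniformizer E)

include hϖ

theorem weyl_mem_maxCompact : weyl c ϖ i ∈ maxCompact c i := by
  have h : ∀ n m : ℤ, n ≤ m → PowMem n (algebraMap F E ϖ ^ m) := by
    intro n m hnm
    have := powMem_zpow_mul_iff (n := n) (x := 1) hϖ m
    rw [mul_one] at this
    exact this.2 (PowMem.one (by omega))
  refine mem_maxCompact_iff.2 ?_
  simp [weyl_val, PowMem.zero, PowMem.one]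
  exact ⟨by simpa using h _ _ (le_refl (-(i : ℤ))), by simpa using h _ _ (le_refl (i : ℤ))⟩

/-- If `x` is not in `I`, its lower left entry has exact order `i`. The first column, scaled to `(y,
z, 1)`, is then the last column of a unipotent element `n` of `I`, so `s n⁻¹ x` has vanishing lower
left entry and lies in `I`. -/
theorem mem_iwahori_or_of_mem_maxCompact {x : U3 c} (hx : x ∈ maxCompact c i) :
    x ∈ iwahori c i ∨ ∃ a ∈ iwahori c i, ∃ b ∈ iwahori c i, x = a * weyl c ϖ i * b := by
  by_cases h20 : PowMem (1 + i : ℤ) (x.1.1 2 0)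
  · exact Or.inl (mem_iwahori_of_mem_maxCompact hx h20)
  refine Or.inr ?_
  have hv := le_valuation_of_not_powMem (n := i) (by rwa [add_comm])
  have h0 := ne_zero_of_le_valuation hv
  obtain ⟨⟨h00, -, -⟩, ⟨h10, -, -⟩, -⟩ := mem_maxCompact_iff.1 hx
  have hcol := U3.col_rel x 0 0
  norm_num at hcol
  have hiso := isotropic_div h0 hcol
  set z := x.1.1 1 0 / x.1.1 2 0 with hz
  set y := x.1.1 0 0 / x.1.1 2 0 with hy
  have hPz : PowMem 0 z := by simpa using h10.div hv
  have hPy : PowMem (-(i : ℤ)) y := by simpa using h00.div hv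
  have hn : upperUnip c z y hiso ∈ iwahori c i := by
    refine mem_iwahori_iff.2 ?_
    simp only [upperUnip_val]
    simp [PowMem.zero, PowMem.one, hPz, hPy, (powMem_conj.2 hPz).neg]
  have hb : weyl c ϖ i * ((upperUnip c z y hiso)⁻¹ * x) ∈ maxCompact c i :=
    mul_mem (weyl_mem_maxCompact hϖ) (mul_mem (inv_mem (iwahori_le_maxCompact hn)) hx)
  refine ⟨_, hn, _, mem_iwahori_of_upper hb ?_, ?_⟩
  · rw [weyl_mul_apply, U3.mul_apply, upperUnip_inv_val, show Fin.rev (2 : Fin 3) = 0 from rfl]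
    have e1 : x.1.1 0 0 = y * x.1.1 2 0 := by rw [hy]; field_simp
    have e2 : x.1.1 1 0 = z * x.1.1 2 0 := by rw [hz]; field_simp
    simp only [Matrix.of_apply, Matrix.cons_val]
    rw [e1, e2]
    linear_combination (algebraMap F E ϖ ^ ((i : ℤ) * (((2 : Fin 3) : ℤ) - 1)) * x.1.1 2 0) * hiso
  · have := weyl_mul_self (c := c) ϖ i
    calc x = upperUnip c z y hiso * 1 * ((upperUnip c z y hiso)⁻¹ * x) := by group
      _ = _ := by rw [← this]; group

end Bruhat

/-! ### Orders of matrix entries under conjugation by Weyl elements and by powers of `α`. -/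

section Conjugation

variable {F E : Type*} [Field F] [Field E] [ValuativeRel E] [TopologicalSpace E]
  [IsNonarchimedeanLocalField E] [Algebra F E] {c : E ≃ₐ[F] E}
  {ϖ : Fˣ} (hϖ : valuation E (algebraMap F E ϖ) = uniformizer E)

include hϖ

theorem powMem_weyl_conj {n : ℤ} (m : ℤ) (g : U3 c) (a b : Fin 3) :
    PowMem n ((weyl c ϖ m * g * weyl c ϖ m).1.1 a b) ↔
      PowMem (n - m * ((a : ℤ) - b)) (g.1.1 a.rev b.rev) := by
  rw [weyl_conj_apply, powMem_zpow_mul_iff hϖ]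

theorem powMem_alpha_conj {n : ℤ} (m : ℤ) (g : U3 c) (a b : Fin 3) :
    PowMem n ((alpha c ϖ ^ m * g * alpha c ϖ ^ (-m)).1.1 a b) ↔
      PowMem (n - m * ((a : ℤ) - b)) (g.1.1 a b) := by
  rw [alpha_zpow_conj_apply, powMem_zpow_mul_iff hϖ]

end Conjugation

/-! ### Iwahori factorization, the multiplication rules, and the covering of `G` by cells. -/

section Datum

variable {F E : Type*} [Field F] [ValuativeRel F] [TopologicalSpace F]
  [IsNonarchimedeanLocalField F] [Field E] [ValuativeRel E] [TopologicalSpace E]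
  [IsNonarchimedeanLocalField E] [Algebra F E] [ValuativeExtension F E]
  [Algebra.IsQuadraticExtension F E] {c : E ≃ₐ[F] E} {i : Fin 2}

/-- Pairing the first and last columns gives `1`, and all terms except `x₀₀ * c x₂₂` lie in the
maximal ideal. Hence `x₀₀` is a unit. -/
theorem zero_le_valuation_of_mem_iwahori {x : U3 c} (hx : x ∈ iwahori c i) :
    uniformizer E ^ (0 : ℤ) ≤ valuation E (x.1.1 0 0) := by
  by_contra hlt
  have h1 : PowMem 1 (x.1.1 0 0) := by
    by_contra h1
    exact hlt (le_valuation_of_not_powMem (by simpa using h1))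
  obtain ⟨⟨h00, h01, h02⟩, ⟨h10, h11, h12⟩, h20, h21, h22⟩ := mem_iwahori_iff.1 hx
  have hcol := U3.col_rel x 0 2
  norm_num at hcol
  have h : PowMem 1 (1 : E) := by
    rw [← hcol]
    exact ((h1.mul' (powMem_conj.2 h22) (by simp)).add
      (h10.mul' (powMem_conj.2 h12) (by simp))).add (h20.mul' (powMem_conj.2 h02) (by omega))
  have := h.le_of_le_valuation (n := 0) (by simp)
  omega

/-- The Iwahori factorization. -/
theorem exists_lower_mul_upper {x : U3 c} (hx : x ∈ iwahori c i) :
    ∃ n ∈ iwahori c i, ∃ b ∈ iwahori c i, x = n * b ∧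
      (n.1.1 0 1 = 0 ∧ n.1.1 0 2 = 0 ∧ n.1.1 1 2 = 0) ∧
      (b.1.1 1 0 = 0 ∧ b.1.1 2 0 = 0 ∧ b.1.1 2 1 = 0) := by
  have hv := zero_le_valuation_of_mem_iwahori hx
  have h0 := ne_zero_of_le_valuation hv
  obtain ⟨⟨h00, h01, h02⟩, ⟨h10, h11, h12⟩, h20, h21, h22⟩ := mem_iwahori_iff.1 hx
  have hcol := U3.col_rel x 0 0
  norm_num at hcol
  -- The first column divided by the unit `x₀₀` is the first column of a lower unipotent element of
  -- `I`. Removing that factor leaves an upper triangular matrix.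
  have hiso := isotropic_div (c := c) (x := x.1.1 2 0) (y := x.1.1 1 0) h0
    (by linear_combination hcol)
  have e1 : x.1.1 2 0 = x.1.1 2 0 / x.1.1 0 0 * x.1.1 0 0 := by field_simp
  have e2 : x.1.1 1 0 = x.1.1 1 0 / x.1.1 0 0 * x.1.1 0 0 := by field_simp
  have hPz : PowMem 1 (x.1.1 1 0 / x.1.1 0 0) := by simpa using h10.div hv
  have hPy : PowMem (1 + i : ℤ) (x.1.1 2 0 / x.1.1 0 0) := by simpa using h20.div hv
  generalize x.1.1 1 0 / x.1.1 0 0 = z at *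
  generalize x.1.1 2 0 / x.1.1 0 0 = y at *
  have hn : lowerUnip c z y hiso ∈ iwahori c i := by
    refine mem_iwahori_iff.2 ?_
    simp only [lowerUnip_val]
    simp [PowMem.zero, PowMem.one, hPz, hPy, (powMem_conj.2 hPz).neg]
  have hb10 : ((lowerUnip c z y hiso)⁻¹ * x).1.1 1 0 = 0 := by
    rw [U3.mul_apply, lowerUnip_inv_val]
    simp only [Matrix.of_apply, Matrix.cons_val]
    linear_combination e2
  have hb20 : ((lowerUnip c z y hiso)⁻¹ * x).1.1 2 0 = 0 := by
    rw [U3.mul_apply, lowerUnip_inv_val]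
    simp only [Matrix.of_apply, Matrix.cons_val]
    linear_combination e1 + c z * e2 + x.1.1 0 0 * hiso
  exact ⟨_, hn, _, mul_mem (inv_mem hn) hx, by group,
    by simp only [lowerUnip_val]; simp, hb10, hb20, U3.upper_of_col _ hb10 hb20⟩

/-- A lower triangular unitary matrix lies in `I` as soon as its first column does. -/
theorem mem_iwahori_of_lower {b : U3 c} (hu : uniformizer E ^ (0 : ℤ) ≤ valuation E (b.1.1 0 0))
    (h00 : PowMem 0 (b.1.1 0 0)) (h10 : PowMem 1 (b.1.1 1 0))
    (h20 : PowMem (1 + i : ℤ) (b.1.1 2 0)) (h01 : b.1.1 0 1 = 0) (h02 : b.1.1 0 2 = 0) :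
    b ∈ iwahori c i := by
  have h0 := ne_zero_of_le_valuation hu
  have hc0 : c (b.1.1 0 0) ≠ 0 := by simpa using h0
  have r02 := U3.col_rel b 2 0
  have r11 := U3.col_rel b 1 1
  have r12 := U3.col_rel b 1 2
  have r10 := U3.col_rel b 1 0
  norm_num [h01, h02] at r02 r11 r12 r10
  have h11 : PowMem 0 (b.1.1 1 1) :=
    powMem_of_mul_conj (c := c) (n := 0) (by rw [r11]; exact PowMem.one le_rfl) (by simp)
  have h11' : b.1.1 1 1 ≠ 0 := by
    intro h; simp [h] at r11
  have h12 : b.1.1 1 2 = 0 := by simpa [h11'] using r12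
  rw [h12, zero_mul, zero_add] at r02
  have hu' : uniformizer E ^ (0 : ℤ) ≤ valuation E (c (b.1.1 0 0)) := by rwa [valuation_conj]
  have h22 : PowMem 0 (b.1.1 2 2) := by
    rw [eq_div_of_mul_eq hc0 r02]
    exact ((PowMem.one le_rfl).div hu').of_le (m := 0) (by simp)
  have h21 : PowMem 1 (b.1.1 2 1) := by
    rw [eq_div_of_mul_eq hc0 (show b.1.1 2 1 * c (b.1.1 0 0) = -(b.1.1 1 1 * c (b.1.1 1 0)) by
      linear_combination r10)]
    exact ((h11.mul (powMem_conj.2 h10)).neg.div hu').of_le (by simp)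
  refine mem_iwahori_iff.2 ?_
  rw [h01, h02, h12]
  exact ⟨⟨h00, PowMem.zero _, PowMem.zero _⟩, ⟨h10, h11, PowMem.zero _⟩, h20, h21, h22⟩

variable {ϖ : Fˣ} (hϖ : valuation E (algebraMap F E ϖ) = uniformizer E)

include hϖ

theorem weyl_conj_mem_iwahori_of_lower {n : U3 c} (hn : n ∈ iwahori c i)
    (h01 : n.1.1 0 1 = 0) (h02 : n.1.1 0 2 = 0) (h12 : n.1.1 1 2 = 0) :
    weyl c ϖ i * n * weyl c ϖ i ∈ iwahori c i := by
  obtain ⟨⟨h00, -, -⟩, ⟨h10, h11, -⟩, h20, h21, h22⟩ := mem_iwahori_iff.1 hn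
  have := natCast_le_one i
  refine mem_iwahori_iff.2 ?_
  simp only [powMem_weyl_conj hϖ]
  simp [Fin.rev, h01, h02, h12, PowMem.zero]
  exact ⟨⟨h22, h21.of_le this, h20.of_le (by omega)⟩, ⟨h11, h10.of_le this⟩, h00⟩

theorem weyl_succ_conj_mem_iwahori_of_upper {b : U3 c} (hb : b ∈ iwahori c i)
    (h10 : b.1.1 1 0 = 0) (h20 : b.1.1 2 0 = 0) (h21 : b.1.1 2 1 = 0) :
    weyl c ϖ (i + 1) * b * weyl c ϖ (i + 1) ∈ iwahori c i := by
  obtain ⟨⟨h00, h01, h02⟩, ⟨-, h11, h12⟩, -, -, h22⟩ := mem_iwahori_iff.1 hb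
  refine mem_iwahori_iff.2 ?_
  simp only [powMem_weyl_conj hϖ]
  simp [Fin.rev, h10, h20, h21, PowMem.zero]
  exact ⟨h22, ⟨h12.of_le (by omega), h11⟩, h02.of_le (by omega), h01.of_le (by omega), h00⟩

/-- With `x = l b` the product becomes `(s l s) α⁻ⁿ s (α⁻ⁿ b αⁿ)`: conjugation by `s` keeps the
lower factor in `I`, and conjugation by `α⁻ⁿ` contracts the upper one. -/
theorem weyl_mul_mul_alpha_mem_cell (n : ℕ) {x : U3 c} (hx : x ∈ iwahori c i) :
    weyl c ϖ i * x * alpha c ϖ ^ (n : ℤ) ∈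
      cell (maxCompact c i) (iwahori c i) (alpha c ϖ) (-n) := by
  obtain ⟨l, hl, b, hb, rfl, ⟨l01, l02, l12⟩, b10, b20, b21⟩ := exists_lower_mul_upper hx
  have hbK : alpha c ϖ ^ (-n : ℤ) * b * alpha c ϖ ^ (- -n : ℤ) ∈ maxCompact c i := by
    obtain ⟨⟨h00, h01, h02⟩, ⟨-, h11, h12⟩, -, -, h22⟩ := mem_iwahori_iff.1 hb
    refine mem_maxCompact_iff.2 ?_
    simp only [powMem_alpha_conj hϖ]
    simp [b10, b20, b21, PowMem.zero]
    exact ⟨⟨h00, h01.of_le (by omega), h02.of_le (by omega)⟩,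
      ⟨h11, h12.of_le (by omega)⟩, h22⟩
  refine ⟨_, weyl_conj_mem_iwahori_of_lower hϖ hl l01 l02 l12, _,
    mul_mem (weyl_mem_maxCompact hϖ) hbK, ?_⟩
  have hw := weyl_mul_self (c := c) ϖ i
  have hs := mul_zpow_of_involutive (alpha_eq_weyl_mul (c := c) ϖ i) hw
    (weyl_mul_self (c := c) ϖ (i + 1)) (-n)
  calc weyl c ϖ i * (l * b) * alpha c ϖ ^ (n : ℤ)
      = weyl c ϖ i * l * 1 * b * alpha c ϖ ^ (n : ℤ) := by group
    _ = weyl c ϖ i * l * weyl c ϖ i * (alpha c ϖ ^ (-n : ℤ) * alpha c ϖ ^ (- -n : ℤ) *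
          weyl c ϖ i) * b * alpha c ϖ ^ (n : ℤ) := by rw [← hw]; group
    _ = weyl c ϖ i * l * weyl c ϖ i * (alpha c ϖ ^ (-n : ℤ) * (weyl c ϖ i *
          alpha c ϖ ^ (-n : ℤ))) * b * alpha c ϖ ^ (n : ℤ) := by rw [hs]; group
    _ = _ := by group

/-- Here the upper factor must stand first, since it is the one that `s'` conjugates into `I`, while
`αⁿ` contracts the lower one. Factoring `x⁻¹` supplies this order, and `s' α⁻ⁿ = αⁿ⁺¹ s`. -/
theorem weyl_succ_mul_mul_alpha_mem_cell (n : ℕ) {x : U3 c} (hx : x ∈ iwahori c i) :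
    weyl c ϖ (i + 1) * x * alpha c ϖ ^ (-n : ℤ) ∈
      cell (maxCompact c i) (iwahori c i) (alpha c ϖ) (n + 1) := by
  obtain ⟨l, hl, b, hb, h, ⟨l01, l02, l12⟩, b10, b20, b21⟩ :=
    exists_lower_mul_upper (inv_mem hx)
  obtain rfl : x = b⁻¹ * l⁻¹ := by rw [← mul_inv_rev, ← h, inv_inv]
  have hlK : alpha c ϖ ^ (n : ℤ) * l⁻¹ * alpha c ϖ ^ (-n : ℤ) ∈ maxCompact c i := by
    have hl' := inv_mem hl
    have k01 : (l⁻¹).1.1 0 1 = 0 := by rw [U3.inv_apply]; simpa using l12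
    have k02 : (l⁻¹).1.1 0 2 = 0 := by rw [U3.inv_apply]; simpa using l02
    have k12 : (l⁻¹).1.1 1 2 = 0 := by rw [U3.inv_apply]; simpa using l01
    generalize l⁻¹ = l' at hl' k01 k02 k12
    obtain ⟨⟨h00, -, -⟩, ⟨h10, h11, -⟩, h20, h21, h22⟩ := mem_iwahori_iff.1 hl'
    have := natCast_le_one i
    refine mem_maxCompact_iff.2 ?_
    simp only [powMem_alpha_conj hϖ, k01, k02, k12]
    simp [PowMem.zero]
    exact ⟨h00, ⟨h10.of_le (by omega), h11⟩, h20.of_le (by omega), h21.of_le (by omega), h22⟩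
  have hbI : weyl c ϖ (i + 1) * b⁻¹ * weyl c ϖ (i + 1) ∈ iwahori c i := by
    have k10 : (b⁻¹).1.1 1 0 = 0 := by rw [U3.inv_apply]; simpa using b21
    have k20 : (b⁻¹).1.1 2 0 = 0 := by rw [U3.inv_apply]; simpa using b20
    have k21 : (b⁻¹).1.1 2 1 = 0 := by rw [U3.inv_apply]; simpa using b10
    exact weyl_succ_conj_mem_iwahori_of_upper hϖ (inv_mem hb) k10 k20 k21
  refine ⟨_, hbI, _, mul_mem (weyl_mem_maxCompact hϖ) hlK, ?_⟩
  have hw := weyl_mul_self (c := c) ϖ i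
  have hw' := weyl_mul_self (c := c) ϖ (i + 1)
  have hα := alpha_eq_weyl_mul (c := c) ϖ i
  have hs := mul_zpow_of_involutive hα hw hw' n
  have hαw : alpha c ϖ * weyl c ϖ i = weyl c ϖ (i + 1) := by rw [hα, mul_assoc, hw, mul_one]
  have key : weyl c ϖ (i + 1) * alpha c ϖ ^ (-n : ℤ) =
      alpha c ϖ ^ (n + 1 : ℤ) * weyl c ϖ i := by
    have hs' := mul_zpow_of_involutive hα hw hw' (-n)
    rw [← hαw, mul_assoc, hs', neg_neg, ← mul_assoc, ← zpow_one_add, add_comm]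
  calc weyl c ϖ (i + 1) * (b⁻¹ * l⁻¹) * alpha c ϖ ^ (-n : ℤ)
      = weyl c ϖ (i + 1) * b⁻¹ * 1 * l⁻¹ * alpha c ϖ ^ (-n : ℤ) := by group
    _ = weyl c ϖ (i + 1) * b⁻¹ * weyl c ϖ (i + 1) * (weyl c ϖ (i + 1) * alpha c ϖ ^ (-n : ℤ)) *
          alpha c ϖ ^ (n : ℤ) * l⁻¹ * alpha c ϖ ^ (-n : ℤ) := by rw [← hw']; group
    _ = _ := by rw [key]; group

/-- For `y = s' x s'` only the upper right entry decides membership in `I`. If its order is too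
small it equals `-1 - i` exactly; the first row scaled to `(r, q, 1)` is then the last row of a
lower unipotent `n ∈ I`, and `y n⁻¹ s'` is lower triangular in `I`. -/
theorem weyl_succ_conj_mem_iwahori_or {x : U3 c} (hx : x ∈ iwahori c i) :
    weyl c ϖ (i + 1) * x * weyl c ϖ (i + 1) ∈ iwahori c i ∨
      ∃ a ∈ iwahori c i, ∃ b ∈ iwahori c i,
        weyl c ϖ (i + 1) * x * weyl c ϖ (i + 1) = a * weyl c ϖ (i + 1) * b := by
  obtain ⟨⟨h00, h01, h02⟩, ⟨h10, h11, h12⟩, h20, h21, h22⟩ := mem_iwahori_iff.1 hx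
  have := natCast_le_one i
  have k00 := (powMem_weyl_conj hϖ (n := 0) (i + 1) x 0 0).2 (h22.of_le (by simp))
  have k10 := (powMem_weyl_conj hϖ (n := 1) (i + 1) x 1 0).2 (h12.of_le (by simp))
  have k11 := (powMem_weyl_conj hϖ (n := 0) (i + 1) x 1 1).2 (h11.of_le (by simp))
  have k20 := (powMem_weyl_conj hϖ (n := 1 + i) (i + 1) x 2 0).2 (h02.of_le (by simp; omega))
  have k21 := (powMem_weyl_conj hϖ (n := 1) (i + 1) x 2 1).2 (h01.of_le (by simp))
  have k22 := (powMem_weyl_conj hϖ (n := 0) (i + 1) x 2 2).2 (h00.of_le (by simp))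
  have k01 := (powMem_weyl_conj hϖ (n := -i) (i + 1) x 0 1).2 (h21.of_le (by simp))
  have k02' := (powMem_weyl_conj hϖ (n := -1 - i) (i + 1) x 0 2).2 (h20.of_le (by simp; omega))
  have k12 := (powMem_weyl_conj hϖ (n := -i) (i + 1) x 1 2).2 (h10.of_le (by simp))
  generalize weyl c ϖ (i + 1) * x * weyl c ϖ (i + 1) = y at *
  have hrow := U3.row_rel y 0 0
  have hcol := U3.col_rel y 2 2
  norm_num at hrow hcol
  by_cases k02 : PowMem (-(i : ℤ)) (y.1.1 0 2)
  · exact Or.inl (mem_iwahori_iff.2 ⟨⟨k00, powMem_of_isotropic hrow k00 k02 (by omega), k02⟩,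
      ⟨k10, k11, powMem_of_isotropic hcol k02 k22 (by omega)⟩, k20, k21, k22⟩)
  have hv := le_valuation_of_not_powMem (n := -1 - i) (x := y.1.1 0 2)
    (by rwa [show (-1 - (i : ℤ) + 1) = -i by ring])
  have h0 := ne_zero_of_le_valuation hv
  have hiso := isotropic_div h0 hrow
  have e0 : y.1.1 0 0 = y.1.1 0 0 / y.1.1 0 2 * y.1.1 0 2 := by field_simp
  have e1 : y.1.1 0 1 = y.1.1 0 1 / y.1.1 0 2 * y.1.1 0 2 := by field_simp
  have hP : PowMem (1 + i : ℤ) (y.1.1 0 0 / y.1.1 0 2) := (k00.div hv).of_le (by omega)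
  have hQ : PowMem 1 (y.1.1 0 1 / y.1.1 0 2) := (k01.div hv).of_le (by omega)
  generalize y.1.1 0 0 / y.1.1 0 2 = r at *
  generalize y.1.1 0 1 / y.1.1 0 2 = q at *
  have hiso' : r + c r + -c q * c (-c q) = 0 := by
    rw [map_neg, conj_conj]; linear_combination hiso
  have hn : lowerUnip c (-c q) r hiso' ∈ iwahori c i := by
    refine mem_iwahori_iff.2 ?_
    simp only [lowerUnip_val]
    simp [PowMem.zero, PowMem.one, hP, conj_conj, hQ, (powMem_conj.2 hQ).neg]
  -- The factor `n⁻¹` leaves the last column of `y` alone, and `s'` moves it to the front with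
  -- scaling `ϖ ^ (i + 1)`; this makes the corner entry a unit.
  have hb0 : ∀ a, (y * (lowerUnip c (-c q) r hiso')⁻¹ * weyl c ϖ (i + 1)).1.1 a 0 =
      algebraMap F E ϖ ^ (i + 1 : ℤ) * y.1.1 a 2 := by
    intro a
    rw [mul_weyl_apply, U3.mul_apply, lowerUnip_inv_val]
    simp [Fin.rev]
  have hb1 : (y * (lowerUnip c (-c q) r hiso')⁻¹ * weyl c ϖ (i + 1)).1.1 0 1 = 0 := by
    rw [mul_weyl_apply, U3.mul_apply, lowerUnip_inv_val]
    simp [Fin.rev, conj_conj]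
    linear_combination e1
  have hb2 : (y * (lowerUnip c (-c q) r hiso')⁻¹ * weyl c ϖ (i + 1)).1.1 0 2 = 0 := by
    have : y.1.1 0 0 + y.1.1 0 1 * c q + y.1.1 0 2 * c r = 0 := by
      linear_combination e0 + c q * e1 + y.1.1 0 2 * hiso
    rw [mul_weyl_apply, U3.mul_apply, lowerUnip_inv_val]
    simp [Fin.rev, conj_conj]
    exact Or.inr this
  refine Or.inr ⟨y * (lowerUnip c (-c q) r hiso')⁻¹ * weyl c ϖ (i + 1), ?_, _, hn, ?_⟩
  · have hu0 : uniformizer E ^ (0 : ℤ) ≤ valuation E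
        ((y * (lowerUnip c (-c q) r hiso')⁻¹ * weyl c ϖ (i + 1)).1.1 0 0) := by
      rw [hb0, le_valuation_zpow_mul_iff hϖ]
      convert hv using 2; ring
    have hp0 : PowMem 0 ((y * (lowerUnip c (-c q) r hiso')⁻¹ * weyl c ϖ (i + 1)).1.1 0 0) := by
      rw [hb0, powMem_zpow_mul_iff hϖ]; exact k02'.of_le (by omega)
    have hp1 : PowMem 1 ((y * (lowerUnip c (-c q) r hiso')⁻¹ * weyl c ϖ (i + 1)).1.1 1 0) := by
      rw [hb0, powMem_zpow_mul_iff hϖ]; exact k12.of_le (by omega)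
    have hp2 : PowMem (1 + i : ℤ)
        ((y * (lowerUnip c (-c q) r hiso')⁻¹ * weyl c ϖ (i + 1)).1.1 2 0) := by
      rw [hb0, powMem_zpow_mul_iff hϖ]; exact k22.of_le (by omega)
    exact mem_iwahori_of_lower hu0 hp0 hp1 hp2 hb1 hb2
  · have := weyl_mul_self (c := c) ϖ (i + 1)
    calc y = y * (lowerUnip c (-c q) r hiso')⁻¹ * 1 * lowerUnip c (-c q) r hiso' := by group
      _ = _ := by rw [← this]; group

theorem isDihedralDatum : IsDihedralDatum (maxCompact c i) (iwahori c i) (weyl c ϖ i)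
    (weyl c ϖ (i + 1)) (alpha c ϖ) where
  le := iwahori_le_maxCompact
  s_mem := weyl_mem_maxCompact hϖ
  alpha_eq := alpha_eq_weyl_mul ϖ i
  s_sq := weyl_mul_self ϖ i
  s'_sq := weyl_mul_self ϖ (i + 1)
  mem_or_of_mem _ hx := mem_iwahori_or_of_mem_maxCompact hϖ hx
  conj_mem_or _ hx := weyl_succ_conj_mem_iwahori_or hϖ hx
  s_mul_mem n _ hx := weyl_mul_mul_alpha_mem_cell hϖ n hx
  s'_mul_mem n _ hx := weyl_succ_mul_mul_alpha_mem_cell hϖ n hx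

-- The last row scaled to `(y, q, 1)` is the last row of a lower unipotent element, which lies in
-- `K` when `y ∈ 𝔭ⁱ`: isotropy gives `q ∈ 𝔭ⁱ`, using `i ≤ 1`. Its inverse clears the row.
omit hϖ in
theorem exists_upper_of_powMem_div {g : U3 c} (h0 : g.1.1 2 2 ≠ 0)
    (hg : PowMem i (g.1.1 2 0 / g.1.1 2 2)) : ∃ k ∈ maxCompact c i,
      (g * k).1.1 2 0 = 0 ∧ (g * k).1.1 2 1 = 0 := by
  have hrow := U3.row_rel g 2 2
  norm_num at hrow
  have hiso := isotropic_div h0 hrow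
  have e0 : g.1.1 2 0 = g.1.1 2 0 / g.1.1 2 2 * g.1.1 2 2 := by field_simp
  have e1 : g.1.1 2 1 = g.1.1 2 1 / g.1.1 2 2 * g.1.1 2 2 := by field_simp
  generalize g.1.1 2 0 / g.1.1 2 2 = y at *
  generalize g.1.1 2 1 / g.1.1 2 2 = q at *
  have := natCast_le_one i
  have hq : PowMem i q := by
    refine powMem_of_mul_conj (c := c) (n := i) ?_ (by omega)
    rw [show q * c q = -y - c y by linear_combination hiso]
    exact hg.neg.sub (powMem_conj.2 hg)
  have hiso' : y + c y + -c q * c (-c q) = 0 := by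
    rw [map_neg, conj_conj]; linear_combination hiso
  have hn : lowerUnip c (-c q) y hiso' ∈ maxCompact c i := by
    refine mem_maxCompact_iff.2 ?_
    simp only [lowerUnip_val]
    simp [PowMem.zero, PowMem.one, hg, conj_conj, hq, (powMem_conj.2 hq).neg]
  refine ⟨_, inv_mem hn, ?_, ?_⟩
  · rw [U3.mul_apply, lowerUnip_inv_val]
    simp [conj_conj]
    linear_combination e0 + c q * e1 + g.1.1 2 2 * hiso
  · rw [U3.mul_apply, lowerUnip_inv_val]
    simp [conj_conj]
    linear_combination e1

/-- The Iwasawa decomposition. -/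
theorem exists_mul_mem_upper (g : U3 c) : ∃ k ∈ maxCompact c i,
    (g * k).1.1 2 0 = 0 ∧ (g * k).1.1 2 1 = 0 := by
  by_cases h : g.1.1 2 2 ≠ 0 ∧ PowMem i (g.1.1 2 0 / g.1.1 2 2)
  · exact exists_upper_of_powMem_div h.1 h.2
  have hϖ0 : algebraMap F E ϖ ≠ 0 := by simp
  -- Otherwise the first entry of the last row dominates. Right multiplication by `s` swaps the
  -- outer entries and multiplies the inverse ratio by `ϖ ^ (2 i)`, which brings it into `𝔭ⁱ`.
  have h1 : g.1.1 2 0 ≠ 0 ∧ PowMem (-(i : ℤ)) (g.1.1 2 2 / g.1.1 2 0) := by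
    have hrow := U3.row_rel g 2 2
    norm_num at hrow
    by_cases h22 : g.1.1 2 2 = 0
    · have h21 : g.1.1 2 1 = 0 := by simpa [h22] using hrow
      refine ⟨fun h20 => ?_, by simp [h22, PowMem.zero]⟩
      have := U3.row_rel g 2 0
      simp [h20, h21, h22] at this
    · have hv := le_valuation_of_not_powMem (n := i - 1) (x := g.1.1 2 0 / g.1.1 2 2)
        (by simpa using fun h' => h ⟨h22, h'⟩)
      have hne := ne_zero_of_le_valuation hv
      refine ⟨fun h20 => hne (by simp [h20]), ?_⟩
      rw [← one_div_div]
      exact ((PowMem.one le_rfl).div hv).of_le (by omega)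
  have hw : ∀ b, (g * weyl c ϖ i).1.1 2 b = _ := fun b => mul_weyl_apply ϖ i g 2 b
  obtain ⟨k, hk, h20, h21⟩ := exists_upper_of_powMem_div (i := i) (g := g * weyl c ϖ i)
    (by
      rw [hw]
      exact mul_ne_zero (zpow_ne_zero _ hϖ0) h1.1)
    (by
      have e : (g * weyl c ϖ i).1.1 2 0 / (g * weyl c ϖ i).1.1 2 2 =
          algebraMap F E ϖ ^ (2 * i : ℤ) * (g.1.1 2 2 / g.1.1 2 0) := by
        rw [hw, hw, mul_div_mul_comm, ← zpow_sub₀ hϖ0]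
        congr 2
        simp
        ring
      rw [e, powMem_zpow_mul_iff hϖ]
      exact h1.2.of_le (by omega))
  exact ⟨weyl c ϖ i * k, mul_mem (weyl_mem_maxCompact hϖ) hk, by rwa [← mul_assoc],
    by rwa [← mul_assoc]⟩

/-- An element of `K` on the right makes `g` upper triangular, and a power of `α` on the left makes
the diagonal integral. Conjugation by a large negative power of `α` then contracts it into `I`; the
powers of `α` are undone because left multiplication by them preserves the union of the cells. -/
theorem exists_mem_cell (g : U3 c) :
    ∃ n, g ∈ cell (maxCompact c i) (iwahori c i) (alpha c ϖ) n := by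
  obtain ⟨k, hk, h20, h21⟩ := exists_mul_mem_upper (i := i) hϖ g
  suffices h : ∃ n, g * k ∈ cell (maxCompact c i) (iwahori c i) (alpha c ϖ) n by
    obtain ⟨n, hn⟩ := h
    exact ⟨n, by simpa using right_mul_mem_cell hn (inv_mem hk)⟩
  generalize g * k = b at *
  have h10 := U3.upper_of_row b h20 h21
  have h00 : b.1.1 0 0 ≠ 0 := by
    intro h00
    have := U3.col_rel b 0 2
    simp [h00, h10, h20] at this
  obtain ⟨n, hn⟩ := exists_valuation_eq_zpow h00
  have hd := isDihedralDatum (c := c) (i := i) hϖ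
  suffices h : ∃ m, alpha c ϖ ^ n * b ∈ cell (maxCompact c i) (iwahori c i) (alpha c ϖ) m by
    have := hd.exists_mem_cell_zpow_mul h (-n)
    rwa [← mul_assoc, ← zpow_add, neg_add_cancel, zpow_zero, one_mul] at this
  have k00 : valuation E ((alpha c ϖ ^ n * b).1.1 0 0) = 1 := by
    rw [alpha_zpow_mul_apply]
    simp [hn, hϖ, inv_mul_cancel₀ (zpow_ne_zero n (uniformizer_ne_zero (R := E)))]
  have k10 : (alpha c ϖ ^ n * b).1.1 1 0 = 0 := by rw [alpha_zpow_mul_apply, h10, mul_zero]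
  have k20 : (alpha c ϖ ^ n * b).1.1 2 0 = 0 := by rw [alpha_zpow_mul_apply, h20, mul_zero]
  have k21 : (alpha c ϖ ^ n * b).1.1 2 1 = 0 := by rw [alpha_zpow_mul_apply, h21, mul_zero]
  generalize alpha c ϖ ^ n * b = a at *
  have r02 := U3.col_rel a 0 2
  have r11 := U3.row_rel a 1 1
  norm_num [k10, k20, k21] at r02 r11
  have k11 : PowMem 0 (a.1.1 1 1) :=
    powMem_of_mul_conj (c := c) (n := 0) (by rw [r11]; exact PowMem.one le_rfl) (by simp)
  have k22 : PowMem 0 (a.1.1 2 2) := by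
    have := congrArg (valuation E) r02
    rw [map_mul, k00, one_mul, valuation_conj, map_one] at this
    rw [PowMem, this]; simp
  obtain ⟨N1, hN1⟩ := exists_powMem (a.1.1 0 1)
  obtain ⟨N2, hN2⟩ := exists_powMem (a.1.1 0 2)
  obtain ⟨N3, hN3⟩ := exists_powMem (a.1.1 1 2)
  -- Any `r` that absorbs the denominators of the three entries above the diagonal works.
  let r : ℕ := N1.natAbs + N2.natAbs + N3.natAbs
  have hr : alpha c ϖ ^ (-r : ℤ) * a * alpha c ϖ ^ (- -r : ℤ) ∈ iwahori c i := by
    refine mem_iwahori_iff.2 ?_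
    simp only [powMem_alpha_conj hϖ, k10, k20, k21]
    simp [PowMem.zero, k11, k22]
    exact ⟨⟨by simp [PowMem, k00], hN1.of_le (by omega), hN2.of_le (by omega)⟩,
      hN3.of_le (by omega)⟩
  have h : ∃ m, alpha c ϖ ^ (-r : ℤ) * a ∈
      cell (maxCompact c i) (iwahori c i) (alpha c ϖ) m := by
    refine ⟨-r, _, hr, 1, one_mem _, ?_⟩
    group
  have := hd.exists_mem_cell_zpow_mul h r
  rwa [← mul_assoc, ← zpow_add, add_neg_cancel, zpow_zero, one_mul] at this

end Datum

/-! ### Fixed vectors of pro-`p` groups -/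

section FixedVectors

/-- The span of the orbit over the prime field is a finite set of order divisible by `p`, on which
the group acts through a finite `p`-group. Counting fixed points modulo `p` yields one besides `0`.
-/
theorem exists_fixed_vector {k H V : Type*} [Field k] [Group H] [AddCommGroup V] [Module k V]
    (p : ℕ) [Fact p.Prime] [CharP k p] (ρ : Representation k H V)
    (hpow : ∀ h v, ∃ n : ℕ, ρ (h ^ p ^ n) v = v) {v : V} (hv : v ≠ 0)
    (hfin : (Set.range fun h => ρ h v).Finite) {Y : Submodule k V}
    (hY : ∀ h, ρ h v ∈ Y) : ∃ w ∈ Y, w ≠ 0 ∧ ∀ h, ρ h w = w := by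
  let := ZMod.algebra k p
  let : Module (ZMod p) V := Module.compHom V (algebraMap (ZMod p) k)
  let S : Submodule (ZMod p) V := Submodule.span (ZMod p) (Set.range fun h => ρ h v)
  have hSY : S.toAddSubgroup ≤ Y.toAddSubgroup := by
    have : S ≤ AddSubgroup.toZModSubmodule p Y.toAddSubgroup := by
      refine Submodule.span_le.2 ?_
      rintro _ ⟨h, rfl⟩
      exact hY h
    exact fun x hx => this hx
  have hvS : v ∈ S := Submodule.subset_span ⟨1, by simp⟩
  have hmap : ∀ h, ∀ s ∈ S, ρ h s ∈ S := by
    intro h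
    have : S ≤ S.comap ((ρ h).toAddMonoidHom.toZModLinearMap p) := by
      refine Submodule.span_le.2 ?_
      rintro _ ⟨h', rfl⟩
      exact Submodule.subset_span ⟨h * h', by simp⟩
    exact fun s hs => this hs
  have : Finite (Set.range fun h => ρ h v) := hfin
  have : Module.Finite (ZMod p) S := Module.Finite.span_of_finite _ hfin
  have : Finite S := Module.finite_of_finite (ZMod p)
  let : MulAction H S :=
    { smul h s := ⟨ρ h s, hmap h s s.2⟩
      one_smul s := Subtype.ext (by show ρ 1 s.1 = s.1; simp)
      mul_smul h h' s := Subtype.ext (by show ρ (h * h') s.1 = ρ h (ρ h' s.1); simp) }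
  let P : Subgroup (Equiv.Perm S) := (MulAction.toPermHom H S).range
  have hP : IsPGroup p P := by
    rintro ⟨_, h, rfl⟩
    choose n hn using fun s : S => hpow h s.1
    classical
    have := Fintype.ofFinite S
    have hfix : ∀ (g : H) (s : S), g • s = s → ∀ m : ℕ, g ^ m • s = s := by
      intro g s hg m
      induction m with
      | zero => simp
      | succ m ih => rw [pow_succ, mul_smul, hg, ih]
    -- The sum is a common exponent for all elements of the finite set, being at least each `n s`.
    refine ⟨∑ s, n s, Subtype.ext ?_⟩
    show (MulAction.toPermHom H S h) ^ p ^ _ = 1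
    rw [← map_pow]
    ext s
    show ((h ^ p ^ (∑ s, n s) • s : S) : V) = s
    rw [← Finset.add_sum_erase _ _ (Finset.mem_univ s), pow_add, pow_mul]
    exact congrArg Subtype.val (hfix _ s (Subtype.ext (hn s)) _)
  have hcard : p ∣ Nat.card S := by
    have h1 : addOrderOf (⟨v, hvS⟩ : S) = p := by
      refine addOrderOf_eq_prime (Subtype.ext ?_) (fun h0 => hv (congrArg Subtype.val h0))
      show p • v = 0
      rw [← Nat.cast_smul_eq_nsmul k, CharP.cast_eq_zero, zero_smul]
    exact h1.symm.dvd.trans (addOrderOf_dvd_natCard _)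
  have h0 : (0 : S) ∈ MulAction.fixedPoints P S := by
    rintro ⟨_, h, rfl⟩
    refine Subtype.ext ?_
    show ρ h 0 = 0
    exact map_zero _
  obtain ⟨w, hw, hw0⟩ := hP.exists_fixed_point_of_prime_dvd_card_of_fixed_point S hcard h0
  refine ⟨w, hSY w.2, fun h => hw0 (Subtype.ext h.symm), fun h => ?_⟩
  exact congrArg Subtype.val (hw ⟨_, h, rfl⟩)

end FixedVectors

/-! ### Pro-`p` Iwahori subgroups -/

section Filtration

variable {E : Type*} [Field E] [ValuativeRel E] [TopologicalSpace E]
  [IsNonarchimedeanLocalField E]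

theorem PowMem.add_pow {n : ℤ} {k : ℕ} {x y : E} (hx : PowMem n (x ^ k)) (hy : PowMem n (y ^ k)) :
    PowMem n ((x + y) ^ k) := by
  rw [PowMem, map_pow] at *
  rcases le_total (valuation E x) (valuation E y) with h | h
  · exact (pow_le_pow_left₀ zero_le
      ((Valuation.map_add _ _ _).trans (max_le h le_rfl)) _).trans hy
  · exact (pow_le_pow_left₀ zero_le
      ((Valuation.map_add _ _ _).trans (max_le le_rfl h)) _).trans hx

theorem PowMem.of_pow_four {n : ℤ} {x : E} (hx : PowMem (4 * n) (x ^ 4)) : PowMem n x := by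
  rw [PowMem, map_pow, mul_comm, zpow_mul] at hx
  exact (pow_le_pow_iff_left₀ zero_le zero_le four_ne_zero).1 (by exact_mod_cast hx)

/-- The matrices whose `(a, b)` entry has valuation at least `(m - w (b - a)) / 4`. -/
def filtration (E : Type*) [Field E] [ValuativeRel E] [TopologicalSpace E]
    [IsNonarchimedeanLocalField E] (w m : ℤ) : AddSubgroup (Matrix (Fin 3) (Fin 3) E) where
  carrier := {X | ∀ a b : Fin 3, PowMem (m - w * ((b : ℤ) - a)) (X a b ^ 4)}
  zero_mem' a b := by simp [PowMem.zero]
  add_mem' hX hY a b := (hX a b).add_pow (hY a b)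
  neg_mem' {X} hX a b := by
    have := hX a b
    rwa [Matrix.neg_apply, Even.neg_pow (by decide)]

variable {w m l : ℤ} {X Y : Matrix (Fin 3) (Fin 3) E}

theorem filtration_antitone (h : m ≤ l) : filtration E w l ≤ filtration E w m :=
  fun _ hX a b => (hX a b).of_le (by omega)

theorem one_mem_filtration : (1 : Matrix (Fin 3) (Fin 3) E) ∈ filtration E w 0 := by
  intro a b
  by_cases h : a = b
  · subst h; simp [PowMem.one]
  · simp [h, PowMem.zero]

theorem mul_mem_filtration (hX : X ∈ filtration E w m) (hY : Y ∈ filtration E w l) :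
    X * Y ∈ filtration E w (m + l) := by
  intro a b
  have h : ∀ d, PowMem (m + l - w * ((b : ℤ) - a)) ((X a d * Y d b) ^ 4) := by
    intro d
    rw [mul_pow]
    exact (hX a d).mul' (hY d b) (by linarith)
  rw [Matrix.mul_apply, Fin.sum_univ_three]
  exact ((h 0).add_pow (h 1)).add_pow (h 2)

theorem pow_mem_filtration (hX : X ∈ filtration E w 0) (n : ℕ) : X ^ n ∈ filtration E w 0 := by
  induction n with
  | zero => simpa using one_mem_filtration
  | succ n ih => simpa [pow_succ] using mul_mem_filtration ih hX

/-- With `Z = X - 1`, the difference `Xᵖ - 1` is `Zᵖ` plus `p Z` times a polynomial in `Z` with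
integer coefficients. The first term has depth at least `2 m`, the second at least `m + 4`. -/
theorem pow_sub_one_mem_filtration {p : ℕ} (hp : p.Prime) (hpE : PowMem 1 (p : E)) (hm : 1 ≤ m)
    (hX : X - 1 ∈ filtration E w m) : X ^ p - 1 ∈ filtration E w (m + 1) := by
  obtain ⟨Z, rfl⟩ : ∃ Z, X = Z + 1 := ⟨X - 1, by simp⟩
  rw [add_sub_cancel_right] at hX
  have hX0 := filtration_antitone (show 0 ≤ m by omega) hX
  rw [(Commute.one_right Z).add_pow_prime_eq hp, one_pow, add_sub_right_comm,
    add_sub_cancel_right]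
  refine add_mem ?_ ?_
  · obtain ⟨n, rfl⟩ : ∃ n, p = n + 2 := ⟨p - 2, by have := hp.two_le; omega⟩
    rw [pow_add, pow_two]
    exact filtration_antitone (by omega)
      (mul_mem_filtration (pow_mem_filtration hX0 n) (mul_mem_filtration hX hX))
  · have hsum : ∑ k ∈ Finset.Ioo 0 p, Z ^ (k - 1) * 1 ^ (p - k - 1) * ((p.choose k / p : ℕ) : Matrix (Fin 3) (Fin 3) E) ∈
        filtration E w 0 := by
      refine sum_mem fun k _ => ?_
      rw [one_pow, mul_one, ← nsmul_eq_mul']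
      exact nsmul_mem (pow_mem_filtration hX0 _) _
    have hp4 : (p : Matrix (Fin 3) (Fin 3) E) ∈ filtration E w 4 := by
      intro a b
      by_cases h : a = b
      · subst h
        have : PowMem 4 ((p : E) ^ 4) := by
          rw [PowMem, map_pow]
          refine (pow_le_pow_left₀ zero_le hpE 4).trans ?_
          rw [zpow_one]; exact_mod_cast le_rfl
        simpa [Matrix.natCast_apply] using this
      · simp [Matrix.natCast_apply, h, PowMem.zero]
    rw [mul_one]
    exact filtration_antitone (by omega)
      (mul_mem_filtration (mul_mem_filtration hp4 hX) hsum)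

theorem pow_pow_sub_one_mem_filtration {p : ℕ} (hp : p.Prime) (hpE : PowMem 1 (p : E))
    (hX : X - 1 ∈ filtration E w 1) (n : ℕ) : X ^ p ^ n - 1 ∈ filtration E w (n + 1) := by
  induction n with
  | zero => simpa using hX
  | succ n ih =>
    rw [pow_succ, pow_mul]
    exact_mod_cast pow_sub_one_mem_filtration hp hpE (by omega) ih

theorem tendsto_of_powMem {y : ℕ → E} {z : E} (h : ∀ n : ℕ, PowMem n (y n - z)) :
    Filter.Tendsto y Filter.atTop (nhds z) := by
  intro s hs
  obtain ⟨γ, hγ⟩ := IsValuativeTopology.mem_nhds_iff'.1 hs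
  obtain ⟨t, ht⟩ := ValuativeRel.valuation_surjective (γ : ValueGroupWithZero E)
  obtain ⟨k, hk⟩ := exists_valuation_eq_zpow (x := t) (by
    rintro rfl
    rw [map_zero] at ht
    exact γ.ne_zero ht.symm)
  refine Filter.mem_map.2 (Filter.mem_atTop_sets.2 ⟨k.natAbs + 1, fun n hn => hγ ?_⟩)
  refine lt_of_le_of_lt (h n) ?_
  rw [← ht, hk]
  exact zpow_lt_zpow_right_of_lt_one₀ uniformizer_pos uniformizer_lt_one (by omega)

/-- The weight `1 + 2 i` places the filtration at an interior point of the alcove of `I`, so that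
all entries of `X` get positive depth at once. Depths are quarters of integers, whence the fourth
powers. -/
theorem mem_filtration_one_of_powMem (i : Fin 2) (hd : ∀ a, PowMem 1 (X a a))
    (h : ∀ a b, PowMem (iwahoriExponent i a b) (X a b)) :
    X ∈ filtration E (1 + 2 * i) 1 := by
  have key : ∀ {n l : ℤ} {x : E}, PowMem n x → l ≤ 4 * n → PowMem l (x ^ 4) := by
    intro n l x hx hl
    refine PowMem.of_le hl ?_
    rw [PowMem, map_pow, mul_comm, zpow_mul]
    exact_mod_cast pow_le_pow_left₀ zero_le hx 4
  intro a b
  by_cases hab : a = b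
  · subst hab
    exact key (hd a) (by simp)
  · refine key (h a b) ?_
    clear h hd
    revert i a b
    decide

/-- The constant `6` is the largest weight shift `w * (b - a)`, attained at `w = 3` and `b - a = 2`.
-/
theorem powMem_of_mem_filtration {n : ℤ} (i : Fin 2)
    (h : X ∈ filtration E (1 + 2 * i) (4 * n + 6)) (a b : Fin 3) : PowMem n (X a b) := by
  refine ((h a b).of_le ?_).of_pow_four
  have : (1 + 2 * (i : ℤ)) * ((b : ℤ) - a) ≤ 6 := by
    clear h
    revert i a b
    decide
  omega

end Filtration

/-! ### Convergence of `p`-power sequences, and compactness of `K`. -/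

section Topology

/-- The embedding of the unitary group into pairs of matrices. -/
theorem isInducing_embedProduct_U3 {F E : Type*} [Field F] [Field E] [TopologicalSpace E] [Algebra F E] (c : E ≃ₐ[F] E) :
    Topology.IsInducing fun g : U3 c => Units.embedProduct _ g.1 :=
  Units.isInducing_embedProduct.comp Topology.IsInducing.subtypeVal


variable {F E : Type*} [Field F] [ValuativeRel F] [TopologicalSpace F]
  [IsNonarchimedeanLocalField F] [Field E] [ValuativeRel E] [TopologicalSpace E]
  [IsNonarchimedeanLocalField E] [Algebra F E] [ValuativeExtension F E]
  {c : E ≃ₐ[F] E} {i : Fin 2}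

theorem powMem_one_of_charP (p : ℕ) [CharP 𝓀[F] p] : PowMem 1 (p : E) := by
  have hF : valuation F (p : F) < 1 := by
    have h0 : IsLocalRing.residue 𝒪[F] (p : 𝒪[F]) = 0 := by
      rw [map_natCast]; exact CharP.cast_eq_zero _ _
    rw [IsLocalRing.residue_eq_zero_iff, IsLocalRing.mem_maximalIdeal, mem_nonunits_iff,
      (Valuation.integer.integers (valuation F)).isUnit_iff_valuation_eq_one] at h0
    exact lt_of_le_of_ne (p : 𝒪[F]).2 (by simpa using h0)
  rw [PowMem, zpow_one, le_uniformizer_iff, ← map_one (valuation E), ← map_one (algebraMap F E),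
    ← map_natCast (algebraMap F E)]
  rw [← map_one (valuation F)] at hF
  rw [← not_le] at hF ⊢
  rwa [← Valuation.Compatible.vle_iff_le (v := valuation E), ValuativeExtension.vle_iff_vle,
    Valuation.Compatible.vle_iff_le (v := valuation F)]

variable [Algebra.IsQuadraticExtension F E]

theorem continuous_conj (c : E ≃ₐ[F] E) : Continuous c := by
  rw [continuous_iff_continuousAt]
  intro x s hs
  obtain ⟨γ, hγ⟩ := IsValuativeTopology.mem_nhds_iff'.1 hs
  refine Filter.mem_map.2 (IsValuativeTopology.mem_nhds_iff'.2 ⟨γ, fun y hy => hγ ?_⟩)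
  show valuation E (c y - c x) < γ
  rw [← map_sub, valuation_conj]
  exact hy

/-- The topology of `GL₃` also involves the inverse, but the entries of a unitary inverse are
conjugates of the original entries, and conjugation is continuous. -/
theorem tendsto_one_of_powMem {x : ℕ → U3 c}
    (h : ∀ (n : ℕ) (a b : Fin 3), PowMem n (((x n).1.1 - 1) a b)) :
    Filter.Tendsto x Filter.atTop (nhds 1) := by
  have h1 : ∀ a b, Filter.Tendsto (fun n => (x n).1.1 a b) Filter.atTop
      (nhds ((1 : Matrix (Fin 3) (Fin 3) E) a b)) := fun a b =>
    tendsto_of_powMem fun n => by simpa using h n a b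
  rw [(isInducing_embedProduct_U3 c).tendsto_nhds_iff]
  refine Filter.Tendsto.prodMk_nhds ?_ ?_
  · exact tendsto_pi_nhds.2 fun a => tendsto_pi_nhds.2 fun b => h1 a b
  · refine (MulOpposite.continuous_op.tendsto _).comp ?_
    refine tendsto_pi_nhds.2 fun a => tendsto_pi_nhds.2 fun b => ?_
    have h2 := ((continuous_conj c).tendsto _).comp (h1 b.rev a.rev)
    have e : c ((1 : Matrix (Fin 3) (Fin 3) E) b.rev a.rev) =
        ((1 : U3 c)⁻¹).1.1 a b := (U3.inv_apply 1 a b).symm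
    rw [e] at h2
    refine h2.congr fun n => ?_
    exact (U3.inv_apply (x n) a b).symm

/-- `p`-power sequences in the pro-`p` Iwahori subgroup converge to `1`. -/
theorem exists_pow_mem_of_mem_proIwahori (p : ℕ) [Fact p.Prime] [CharP 𝓀[F] p] {g : U3 c}
    (hg : g ∈ proIwahori c i) {s : Set (U3 c)} (hs : s ∈ nhds 1) : ∃ n : ℕ, g ^ p ^ n ∈ s := by
  have hX : g.1.1 - 1 ∈ filtration E (1 + 2 * i) 1 := by
    refine mem_filtration_one_of_powMem i (fun a => ?_) fun a b => ?_
    · rw [Matrix.sub_apply, Matrix.one_apply_eq, PowMem, zpow_one]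
      exact hg.2 a
    · refine PowMem.sub (hg.1 a b) ?_
      by_cases hab : a = b
      · subst hab
        rw [Matrix.one_apply_eq]
        exact PowMem.one ((iwahoriExponent_isGroupExponent i).diag a).le
      · rw [Matrix.one_apply_ne hab]; exact PowMem.zero _
  have ht : Filter.Tendsto (fun n : ℕ => g ^ p ^ (4 * n + 6)) Filter.atTop (nhds 1) := by
    refine tendsto_one_of_powMem fun n a b => ?_
    refine powMem_of_mem_filtration i ?_ a b
    have := pow_pow_sub_one_mem_filtration (Fact.out : p.Prime)
      (powMem_one_of_charP (F := F) p) hX (4 * n + 6)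
    exact filtration_antitone (by push_cast; omega) this
  obtain ⟨n, hn⟩ := (ht.eventually hs).exists
  exact ⟨_, hn⟩

/-- Under `g ↦ (g, g⁻¹)` the image of `K` is cut out by closed conditions in a product of two boxes
of closed balls; the second box is available because `K` is closed under inversion. -/
theorem isCompact_maxCompact (c : E ≃ₐ[F] E) (i : Fin 2) :
    IsCompact (maxCompact c i : Set (U3 c)) := by
  let box : Set (Matrix (Fin 3) (Fin 3) E) :=
    Set.univ.pi fun a => Set.univ.pi fun b => {x | PowMem (compactExponent i a b) x}
  have hbox : IsCompact box := isCompact_univ_pi fun a => isCompact_univ_pi fun b =>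
    IsNonarchimedeanLocalField.isCompact_closedBall E _
  rw [(isInducing_embedProduct_U3 c).isCompact_iff]
  have hT2 : T2Space E := by
    let := IsTopologicalAddGroup.rightUniformSpace E
    have := isUniformAddGroup_of_addCommGroup (G := E)
    have : T0Space E := ValuedRing.separated (Γ₀ := ValueGroupWithZero E)
    infer_instance
  have key : (fun g : U3 c => Units.embedProduct _ g.1) '' (maxCompact c i : Set (U3 c)) =
      (box ×ˢ (MulOpposite.op '' box)) ∩
        ({q | q.1 * q.2.unop = 1} ∩ {q | q.2.unop * q.1 = 1} ∩
          ⋂ v : Fin 3 → E, ⋂ w : Fin 3 → E,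
            {q | herm c (q.1.mulVec v) (q.1.mulVec w) = herm c v w}) := by
    ext ⟨A, B⟩
    constructor
    · rintro ⟨g, hg, h⟩
      obtain ⟨rfl, rfl⟩ := Prod.ext_iff.1 h
      refine ⟨⟨fun a _ b _ => hg a b, g.1.2, fun a _ b _ => inv_mem hg a b, rfl⟩,
        ⟨g.1.3, g.1.4⟩, ?_⟩
      exact Set.mem_iInter₂.2 fun v w => g.2 v w
    · rintro ⟨⟨hA, -⟩, ⟨h1, h2⟩, h3⟩
      refine ⟨⟨⟨A, B.unop, h1, h2⟩, fun v w => Set.mem_iInter₂.1 h3 v w⟩, ?_, rfl⟩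
      exact fun a b => hA a trivial b trivial
  rw [key]
  refine (hbox.prod (hbox.image MulOpposite.continuous_op)).inter_right ?_
  have hc := continuous_conj c
  refine ((isClosed_eq (by fun_prop) (by fun_prop)).inter
    (isClosed_eq (by fun_prop) (by fun_prop))).inter ?_
  refine isClosed_iInter fun v => isClosed_iInter fun w => isClosed_eq ?_ continuous_const
  simp only [herm_eq]
  have hm : ∀ (v : Fin 3 → E) (a : Fin 3), Continuous fun q :
      Matrix (Fin 3) (Fin 3) E × (Matrix (Fin 3) (Fin 3) E)ᵐᵒᵖ => q.1.mulVec v a := by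
    intro v a
    exact (continuous_apply a).comp (continuous_fst.matrix_mulVec continuous_const)
  have hm' := fun v a => hc.comp (hm v a)
  exact (((hm v 0).mul (hm' w 2)).add ((hm v 1).mul (hm' w 1))).add ((hm v 2).mul (hm' w 0))

end Topology

/-! ### Images of spheres under Frobenius reciprocity -/

section Frobenius

variable {k G V W : Type*} [Field k] [Group G] [AddCommGroup V] [Module k V] [AddCommGroup W]
  [Module k W]

open Classical in
/-- The function supported on `K g` with value `w` at `g`. -/
def cosetFunction {K : Subgroup G} (σ : Representation k K W) (g : G) (w : W) : G → W :=
  fun x => if h : x * g⁻¹ ∈ K then σ ⟨x * g⁻¹, h⟩ w else 0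

theorem cosetFunction_self {K : Subgroup G} (σ : Representation k K W) (g : G) (w : W) :
    cosetFunction σ g w g = w := by
  have h : g * g⁻¹ ∈ K := by simp
  rw [cosetFunction, dif_pos h]
  have : (⟨g * g⁻¹, h⟩ : K) = 1 := Subtype.ext (by simp)
  rw [this, map_one, Module.End.one_apply]

variable [TopologicalSpace G] [IsTopologicalGroup G]

theorem isLocallyConstant_of_equivariant {K : Subgroup G} (hK : IsOpen (K : Set G))
    {σ : Representation k K W} (hσ : IsSmooth σ) {f : G → W}
    (hf : ∀ (x : K) (g : G), f (x * g) = σ x (f g)) : IsLocallyConstant f := by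
  refine (IsLocallyConstant.iff_exists_open f).2 fun x => ?_
  refine ⟨(fun y => y * x⁻¹) ⁻¹' (Subtype.val '' {g : K | σ g (f x) = f x}),
    (hK.isOpenMap_subtype_val _ (hσ (f x))).preimage (by fun_prop), ⟨1, by simp, by simp⟩, ?_⟩
  rintro y ⟨g, hg, hgy⟩
  have hgy' : g.1 = y * x⁻¹ := hgy
  have : y = g * x := by rw [hgy']; simp
  rw [this, hf]
  exact hg

theorem cosetFunction_mem {K : Subgroup G} (hK : IsOpen (K : Set G))
    (hKc : IsCompact (K : Set G)) {σ : Representation k K W} (hσ : IsSmooth σ) (g : G) (w : W) :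
    cosetFunction σ g w ∈ compactInd K σ := by
  have heq : ∀ (x : K) (y : G), cosetFunction σ g w (x * y) = σ x (cosetFunction σ g w y) := by
    intro x y
    by_cases h : y * g⁻¹ ∈ K
    · have h' : x * y * g⁻¹ ∈ K := by rw [mul_assoc]; exact mul_mem x.2 h
      rw [cosetFunction, cosetFunction, dif_pos h, dif_pos h', ← Module.End.mul_apply, ← map_mul]
      congr 2
      exact Subtype.ext (mul_assoc _ _ _)
    · have h' : ¬ x * y * g⁻¹ ∈ K := by rwa [mul_assoc, Subgroup.mul_mem_cancel_left _ x.2]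
      rw [cosetFunction, cosetFunction, dif_neg h, dif_neg h', map_zero]
  refine ⟨heq, isLocallyConstant_of_equivariant hK hσ heq, ?_⟩
  refine HasCompactSupport.intro (hKc.image (continuous_mul_const g)) fun x hx => ?_
  exact dif_neg fun h => hx ⟨_, h, by simp⟩

theorem frobenius_cosetFunction {K : Subgroup G} (hK : IsOpen (K : Set G))
    (hKc : IsCompact (K : Set G)) {σ : Representation k K W} (hσ : IsSmooth σ)
    (π : Representation k G V) (j : σ.IntertwiningMap (res π K)) (g : G) (w : W) :
    frobenius hK π j ⟨_, cosetFunction_mem hK hKc hσ g w⟩ = π g⁻¹ (j w) := by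
  show ∑ᶠ x, frobeniusTerm π j ⟨_, cosetFunction_mem hK hKc hσ g w⟩ x = _
  rw [finsum_eq_single _ (Quotient.mk _ g)]
  · show π g⁻¹ (j (cosetFunction σ g w g)) = _
    rw [cosetFunction_self]
  · intro x hx
    induction x using Quotient.inductionOn with
    | h a =>
      have h : ¬ a * g⁻¹ ∈ K := fun h =>
        hx (Quotient.sound (QuotientGroup.rightRel_apply.2 (by simpa using inv_mem h)))
      show π a⁻¹ (j (cosetFunction σ g w a)) = 0
      rw [cosetFunction, dif_neg h, map_zero, map_zero]

theorem frobenius_mem_translateSpan {K : Subgroup G} (hK : IsOpen (K : Set G))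
    {σ : Representation k K W} (π : Representation k G V) (j : σ.IntertwiningMap (res π K))
    (f : compactInd K σ) {A : Set G} (hf : ∀ g, f.1 g ≠ 0 → g⁻¹ ∈ A) :
    frobenius hK π j f ∈ translateSpan π (LinearMap.range j.toLinearMap) A := by
  show ∑ᶠ x, frobeniusTerm π j f x ∈ _
  refine finsum_induction (· ∈ translateSpan π (LinearMap.range j.toLinearMap) A)
    (zero_mem _) (fun _ _ => add_mem) fun x => ?_
  induction x using Quotient.inductionOn with
  | h a =>
    show π a⁻¹ (j (f.1 a)) ∈ _
    by_cases h0 : f.1 a = 0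
    · rw [h0, map_zero, map_zero]; exact zero_mem _
    · exact apply_mem_translateSpan π (hf a h0) ⟨_, rfl⟩

end Frobenius

/-! ### Half spaces as images under Frobenius reciprocity, and pro-`p` Iwahori invariants. -/

section Images

theorem inv_mem_cell_iff {G : Type*} [Group G] {K I : Subgroup G} {α g : G} {n : ℤ} :
    g⁻¹ ∈ cell K I α (-n) ↔ g ∈ (K : Set G) * {α ^ n} * (I : Set G) := by
  constructor
  · rintro ⟨x, hx, y, hy, h⟩
    refine ⟨_, ⟨y⁻¹, inv_mem hy, _, rfl, rfl⟩, x⁻¹, inv_mem hx, ?_⟩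
    rw [← inv_inv g, h]
    group
  · rintro ⟨_, ⟨y, hy, _, rfl, rfl⟩, x, hx, rfl⟩
    exact ⟨x⁻¹, inv_mem hx, y⁻¹, inv_mem hy, by group⟩

variable {F E : Type*} [Field F] [ValuativeRel F] [TopologicalSpace F]
  [IsNonarchimedeanLocalField F] [Field E] [ValuativeRel E] [TopologicalSpace E]
  [IsNonarchimedeanLocalField E] [Algebra F E] [ValuativeExtension F E]
  [Algebra.IsQuadraticExtension F E] {k V W : Type*} [Field k]
  [AddCommGroup V] [Module k V] [AddCommGroup W] [Module k W]
  {c : E ≃ₐ[F] E} {ϖ : Fˣ} {i : Fin 2} {σ : Representation k (maxCompact c i) W}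

/-- Inverting `K αⁿ I` gives `I α⁻ⁿ K`, hence the sign change. Each translate `π g (j w)` is
attained by the function supported on `K g⁻¹` with value `w` there, which belongs to the compact
induction because `σ` is smooth and `K` is open and compact. -/
theorem map_sphere (hσ : IsSmooth σ) (π : Representation k (U3 c) V)
    (j : σ.IntertwiningMap (res π (maxCompact c i))) (n : ℤ) :
    (sphere c ϖ i σ n).toSubmodule.map (frobenius (isOpen_maxCompact c i) π j).toLinearMap =
      translateSpan π (LinearMap.range j.toLinearMap)
        (cell (maxCompact c i) (iwahori c i) (alpha c ϖ) (-n)) := by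
  refine le_antisymm ?_ (translateSpan_le ?_)
  · rintro _ ⟨f, hf, rfl⟩
    exact frobenius_mem_translateSpan _ π j f fun g hg => inv_mem_cell_iff.2 (hf g hg)
  · rintro g hg _ ⟨w, rfl⟩
    have h := frobenius_cosetFunction (isOpen_maxCompact c i) (isCompact_maxCompact c i) hσ π j
      g⁻¹ w
    rw [inv_inv] at h
    refine ⟨⟨_, cosetFunction_mem (isOpen_maxCompact c i) (isCompact_maxCompact c i) hσ g⁻¹ w⟩,
      ?_, h⟩
    intro x hx
    have hxg : x * g ∈ maxCompact c i := by
      by_contra h'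
      exact hx (dif_neg (by simpa using h'))
    refine inv_mem_cell_iff.1 ?_
    have := right_mul_mem_cell hg (inv_mem hxg)
    simpa using this

theorem image_posPart (hσ : IsSmooth σ) (π : Representation k (U3 c) V)
    (j : σ.IntertwiningMap (res π (maxCompact c i))) :
    (image c π j (posPart c ϖ i σ)).toSubmodule =
      posSpan (maxCompact c i) (iwahori c i) (alpha c ϖ) π (LinearMap.range j.toLinearMap) 0 := by
  show Submodule.map _ (⨆ n : ℕ, (sphere c ϖ i σ n).toSubmodule) = _
  rw [Submodule.map_iSup]
  simp only [map_sphere hσ]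
  rw [← translateSpan_iUnion, posSpan]
  congr 1
  ext g
  simp

theorem image_negPart (hσ : IsSmooth σ) (π : Representation k (U3 c) V)
    (j : σ.IntertwiningMap (res π (maxCompact c i))) :
    (image c π j (negPart c ϖ i σ)).toSubmodule =
      negSpan (maxCompact c i) (iwahori c i) (alpha c ϖ) π (LinearMap.range j.toLinearMap) := by
  show Submodule.map _ (⨆ n : ℕ, (sphere c ϖ i σ (-(n + 1))).toSubmodule) = _
  rw [Submodule.map_iSup]
  simp only [map_sphere hσ, neg_neg]
  rw [← translateSpan_iUnion, negSpan]
  congr 1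
  ext g
  simp

theorem iwahoriSubrep_toSubmodule (hσ : IsSmooth σ) (π : Representation k (U3 c) V)
    (j : σ.IntertwiningMap (res π (maxCompact c i))) :
    (iwahoriSubrep c ϖ π j).toSubmodule =
      posSpan (maxCompact c i) (iwahori c i) (alpha c ϖ) π (LinearMap.range j.toLinearMap) 0 ⊓
        negSpan (maxCompact c i) (iwahori c i) (alpha c ϖ) π (LinearMap.range j.toLinearMap) := by
  rw [← image_posPart hσ, ← image_negPart hσ]
  rfl

theorem isIrreducibleFor_range (hσ : σ.IsIrreducible) (π : Representation k (U3 c) V)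
    {j : σ.IntertwiningMap (res π (maxCompact c i))} (hj : Function.Injective j) :
    IsIrreducibleFor π (maxCompact c i) (LinearMap.range j.toLinearMap) where
  ne_bot h := by
    refine bot_ne_top (α := Subrepresentation σ) (Subrepresentation.toSubmodule_injective ?_)
    refine ((Submodule.eq_bot_iff _).2 fun w _ => hj ?_).symm
    rw [map_zero]
    exact (Submodule.eq_bot_iff _).1 h _ ⟨w, rfl⟩
  apply_mem := by
    rintro x hx _ ⟨w, rfl⟩
    exact ⟨σ ⟨x, hx⟩ w, j.isIntertwining _ _ ⟨x, hx⟩ w⟩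
  le_of_stable Y hY := by
    rintro _ hy ⟨w, rfl⟩ hw0
    let S : Subrepresentation σ :=
      { toSubmodule := Y.comap j.toLinearMap
        apply_mem_toSubmodule x v hv := by
          show j (σ x v) ∈ Y
          rw [j.isIntertwining]
          exact hY x x.2 _ hv }
    rcases eq_bot_or_eq_top S with hS | hS
    · have hw : w ∈ S := hy
      rw [hS] at hw
      have : w = 0 := hw
      rw [this, map_zero] at hw0
      exact absurd rfl hw0
    · rintro _ ⟨v, rfl⟩
      have hv : v ∈ S := by rw [hS]; exact Submodule.mem_top
      exact hv

theorem translateSpan_univ {G : Type*} [Group G] {π : Representation k G V} (hπ : π.IsIrreducible)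
    {U : Submodule k V} (hU : U ≠ ⊥) : translateSpan π U Set.univ = ⊤ := by
  let S : Subrepresentation π :=
    { toSubmodule := translateSpan π U Set.univ
      apply_mem_toSubmodule g v hv := map_mem_translateSpan π g (fun _ _ => Set.mem_univ _) hv }
  rcases eq_bot_or_eq_top S with hS | hS
  · refine absurd ((Submodule.eq_bot_iff _).2 fun u hu => ?_) hU
    have h1 := apply_mem_translateSpan π (Set.mem_univ (1 : G)) hu
    rw [map_one, Module.End.one_apply] at h1
    have : u ∈ S := h1
    rw [hS] at this
    exact this
  · exact congrArg Subrepresentation.toSubmodule hS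

/-- Expand the diagonal of `x⁻¹ (g - 1) x`. Each term either contains a diagonal entry of `g - 1`,
which lies in `𝔭`, or follows a closed path of indices through two distinct ones, where the
exponents add up to at least `1`. -/
theorem conj_mem_proIwahori {x g : U3 c} (hx : x ∈ iwahori c i) (hg : g ∈ proIwahori c i) :
    x⁻¹ * g * x ∈ proIwahori c i := by
  refine ⟨mul_mem (mul_mem (inv_mem hx) hg.1) hx, fun a => ?_⟩
  have he := iwahoriExponent_isGroupExponent i
  have e : (x⁻¹ * g * x).1.1 a a - 1 = ∑ d, ∑ b, (x⁻¹).1.1 a d * (g.1.1 - 1) d b * x.1.1 b a := by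
    have h1 : (x⁻¹ * g * x).1.1 - 1 = (x⁻¹).1.1 * (g.1.1 - 1) * x.1.1 := by
      have h2 : (x⁻¹).1.1 * x.1.1 = 1 := x.1.4
      rw [mul_sub, sub_mul, mul_one, h2]
      rfl
    have h3 := congrFun (congrFun h1 a) a
    rw [Matrix.sub_apply, Matrix.one_apply_eq] at h3
    rw [h3, Matrix.mul_apply, Finset.sum_comm]
    simp_rw [Matrix.mul_apply, Finset.sum_mul]
  rw [e]
  refine Valuation.map_sum_le _ fun d _ => Valuation.map_sum_le _ fun b _ => ?_
  rw [← zpow_one (uniformizer E)]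
  have hxi : PowMem _ ((x⁻¹).1.1 a d) := inv_mem hx a d
  have hxb : PowMem _ (x.1.1 b a) := hx b a
  by_cases hdb : d = b
  · subst hdb
    have hgd : PowMem 1 ((g.1.1 - 1) d d) := by
      rw [Matrix.sub_apply, Matrix.one_apply_eq, PowMem, zpow_one]
      exact hg.2 d
    refine (hxi.mul hgd).mul' hxb ?_
    have := he.triangle a a d
    rw [he.diag] at this
    omega
  · have hgd : PowMem (iwahoriExponent i d b) ((g.1.1 - 1) d b) := by
      rw [Matrix.sub_apply, Matrix.one_apply_ne hdb, sub_zero]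
      exact hg.1 d b
    refine (hxi.mul hgd).mul' hxb ?_
    by_cases had : d = a
    · subst had
      have := iwahoriExponent_offDiag i d b (Ne.symm hdb)
      rw [he.diag]
      omega
    · have := iwahoriExponent_offDiag i a d had
      have := he.triangle d a b
      omega

theorem apply_mem_invariants (π : Representation k (U3 c) V) {x : U3 c} (hx : x ∈ iwahori c i)
    {v : V} (hv : v ∈ (res π (proIwahori c i)).invariants) :
    π x v ∈ (res π (proIwahori c i)).invariants := by
  intro g
  have h : π (x⁻¹ * g * x) v = v := hv ⟨_, conj_mem_proIwahori hx g.2⟩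
  show π g (π x v) = π x v
  conv_rhs => rw [← h]
  simp only [← Module.End.mul_apply, ← map_mul]
  congr 2
  group

theorem finite_orbit_maxCompact {π : Representation k (U3 c) V} (hπ : IsSmooth π) (i : Fin 2)
    (v : V) : (Set.range fun g : maxCompact c i => π g v).Finite := by
  have := isCompact_iff_compactSpace.1 (isCompact_maxCompact c i)
  refine IsLocallyConstant.range_finite ((IsLocallyConstant.iff_exists_open _).2 fun x => ?_)
  refine ⟨(fun y : maxCompact c i => x.1⁻¹ * y.1) ⁻¹' {g | π g v = v},
    (hπ v).preimage (by fun_prop), by simp, fun y hy => ?_⟩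
  have hy' : π (x.1⁻¹ * y.1) v = v := hy
  conv_rhs => rw [← hy']
  simp [← Module.End.mul_apply, ← map_mul]

/-- Stabilizers are open and `p`-power sequences in `I₁` tend to `1`, so some `p`-power of each
element fixes a given vector. The orbits are finite because `K` is compact. -/
theorem exists_mem_invariants (p : ℕ) [Fact p.Prime] [CharP 𝓀[F] p] [CharP k p]
    {π : Representation k (U3 c) V} (hπ : IsSmooth π) {Y : Submodule k V} (hY0 : Y ≠ ⊥)
    (hY : ∀ x ∈ iwahori c i, ∀ y ∈ Y, π x y ∈ Y) :
    ∃ w ∈ Y, w ∈ (res π (proIwahori c i)).invariants ∧ w ≠ 0 := by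
  obtain ⟨v, hvY, hv0⟩ := Submodule.exists_mem_ne_zero_of_ne_bot hY0
  obtain ⟨w, hwY, hw0, hw⟩ := exists_fixed_vector p (res π (proIwahori c i))
    (fun h v => exists_pow_mem_of_mem_proIwahori p h.2 ((hπ v).mem_nhds (by simp))) hv0
    ((finite_orbit_maxCompact hπ i v).subset (by
      rintro _ ⟨h, rfl⟩
      exact ⟨⟨h, iwahori_le_maxCompact h.2.1⟩, rfl⟩))
    (fun h => hY h h.2.1 v hvY)
  exact ⟨w, hwY, hw, hw0⟩

end Images

end UnramifiedU3

end

open UnramifiedU3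
theorem proposition3p7 {F E : Type*}
    [Field F] [ValuativeRel F] [TopologicalSpace F] [IsNonarchimedeanLocalField F]
    [Field E] [ValuativeRel E] [TopologicalSpace E] [IsNonarchimedeanLocalField E]
    [Algebra F E] [ValuativeExtension F E] [Algebra.IsQuadraticExtension F E]
    (hunr : IsUnramified F E)
    (p : ℕ) [Fact p.Prime] [CharP 𝓀[F] p] (hp : Odd p)
    (c : E ≃ₐ[F] E) (hc : c ≠ 1)
    (ϖ : Fˣ) (hϖ : valuation E (algebraMap F E ϖ) = uniformizer E)
    (i : Fin 2)
    {V : Type*} [AddCommGroup V] [Module (AlgebraicClosure (ZMod p)) V]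
    (π : Representation (AlgebraicClosure (ZMod p)) (U3 c) V)
    (hπ : π.IsIrreducible) (hπs : IsSmooth π)
    {W : Type*} [AddCommGroup W] [Module (AlgebraicClosure (ZMod p)) W]
    (σ : Representation (AlgebraicClosure (ZMod p)) (maxCompact c i) W)
    (hσ : σ.IsIrreducible) (hσs : IsSmooth σ)
    (j : σ.IntertwiningMap (res π (maxCompact c i))) (hj : Function.Injective j)
    (hsub : (res π (proIwahori c i)).invariants ≤ (iwahoriSubrep c ϖ π j).toSubmodule)
    {W' : Type*} [AddCommGroup W'] [Module (AlgebraicClosure (ZMod p)) W']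
    (σ' : Representation (AlgebraicClosure (ZMod p)) (maxCompact c i) W')
    (hσ' : σ'.IsIrreducible) (hσs' : IsSmooth σ')
    (j' : σ'.IntertwiningMap (res π (maxCompact c i))) (hj' : Function.Injective j') :
    iwahoriSubrep c ϖ π j' = iwahoriSubrep c ϖ π j := by
  have : CharP (AlgebraicClosure (ZMod p)) p := charP_of_injective_algebraMap' (ZMod p) p
  have hU := isIrreducibleFor_range hσ π hj
  have hU' := isIrreducibleFor_range hσ' π hj'
  rw [iwahoriSubrep_toSubmodule hσs] at hsub
  obtain ⟨hpos, hneg⟩ := (isDihedralDatum hϖ).halfSpaces_eq (exists_mem_cell hϖ)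
    (fun x hx v hv => apply_mem_invariants π hx hv) hU hU'
    (fun Y _ hY0 hY => exists_mem_invariants p hπs hY0 hY)
    (exists_mem_invariants p hπs hU'.ne_bot
      fun x hx => hU'.apply_mem x (iwahori_le_maxCompact hx))
    (translateSpan_univ hπ hU'.ne_bot) hsub
  refine Subrepresentation.toSubmodule_injective ?_
  rw [iwahoriSubrep_toSubmodule hσs, iwahoriSubrep_toSubmodule hσs', hpos, hneg]
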